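/- For each $n\ge 1$ let $M=M_n=(\zeta_{ij})_{1\le i\le p,\,1\le j\le n}$ be a random complex $p\times n$ matrix, where $p=p(n)\le n$ and $p/n\to y$ as $n\to\infty$ for some $0<y\le 1$. Suppose that for each $n$ the entries $\zeta_{ij}$ (whose laws may depend on $i,j,n$) are jointly independent with mean zero and variance one ($\mathbf E|\zeta_{ij}|^2=1$), that for some $C_0\ge 2$ the moments $\mathbf E|\zeta_{ij}|^{C_0}$ are bounded by a constant independent of $i,j,n$, that $|\zeta_{ij}|\le K$ almost surely for all $i,j$, where $K=K(n)>1$ may depend on $n$, and that the distribution of $M$ is continuous (has no atoms). Let $0\le\lambda_1(W)\le\dots\le\lambda_p(W)$ be the nontrivial eigenvalues of the $n\times n$ matrix $W=\frac1n M^*M$, that is, its $p$ largest eigenvalues counted with multiplicity (the other $n-p$ are $0$). Put $a=(1-\sqrt y)^2$, $b=(1+\sqrt y)^2$ and $$\rho_{MP,y}(x)=\frac{1}{2\pi xy}\sqrt{(b-x)(x-a)}\,1_{[a,b]}(x).$$ Let $\varepsilon,\delta>0$ be independent of $n$. Then for any interval $I\subset[a+\varepsilon,b-\varepsilon]$ of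 length $|I|\ge K^2\log^{20}n/n$ one has, with overwhelming probability uniformly in $I$, $$\Big|N_I-p\int_I\rho_{MP,y}(x)\,dx\Big|\le\delta p,\qquad N_I:=\#\{1\le i\le p:\lambda_i(W)\in I\}.$$ That is, for every $C>0$ there are constants $B$ and $n_0$ such that for all $n\ge n_0$ and every such interval $I$ the inequality holds with probability at least $1-Bn^{-C}$; here $B,n_0$ may depend on $C$ and on all the data independent of $n$ (the sequence of ensembles, $K(\cdot)$, $y$, $\varepsilon$, $\delta$), but not on $I$ or $n$. -/

import Mathlib

open MeasureTheory ProbabilityTheory Filter Topology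
open scoped Matrix ENNReal NNReal

namespace RandomCovariance

/-- The covariance matrix `W = (1/n) M* M` of a complex `p × n` matrix `M`. -/
noncomputable def covMatrix {p n : ℕ} (M : Matrix (Fin p) (Fin n) ℂ) :
    Matrix (Fin n) (Fin n) ℂ :=
  ((n : ℝ)⁻¹) • (Mᴴ * M)

theorem covMatrix_isHermitian {p n : ℕ} (M : Matrix (Fin p) (Fin n) ℂ) :
    (covMatrix M).IsHermitian := by
  unfold covMatrix Matrix.IsHermitian
  rw [Matrix.conjTranspose_smul, Matrix.conjTranspose_mul, Matrix.conjTranspose_conjTranspose]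
  simp

/-- The nontrivial eigenvalues `λ₁(W) ≤ … ≤ λ_p(W)` of `W = (1/n) M* M` for a `p × n` matrix `M`
with `p ≤ n`: the `p` largest of the `n` eigenvalues of `W` counted with multiplicity, in increasing
order (`eigenvalues₀` lists all of them in decreasing order). The `n - p` eigenvalues left out are
the trivial ones, equal to `0`. -/
noncomputable def eigenvalue {p n : ℕ} (hpn : p ≤ n) (M : Matrix (Fin p) (Fin n) ℂ)
    (i : Fin p) : ℝ :=
  (covMatrix_isHermitian M).eigenvalues₀
    (Fin.cast (Fintype.card_fin n).symm (Fin.castLE hpn i.rev))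

/-- The number of indices `1 ≤ i ≤ p` such that `λ_i(W) ∈ I`. -/
noncomputable def eigenvalueCount {p n : ℕ} (hpn : p ≤ n) (M : Matrix (Fin p) (Fin n) ℂ)
    (I : Set ℝ) : ℕ :=
  Set.ncard {i : Fin p | eigenvalue hpn M i ∈ I}

/-- The left edge `a = (1 - √y)²` of the Marchenko-Pastur law. -/
noncomputable def edgeLeft (y : ℝ) : ℝ := (1 - √y) ^ 2

/-- The right edge `b = (1 + √y)²` of the Marchenko-Pastur law. -/
noncomputable def edgeRight (y : ℝ) : ℝ := (1 + √y) ^ 2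

/-- The Marchenko-Pastur density
`ρ_{MP,y}(x) = (1 / (2 π x y)) √((b - x)(x - a)) 1_{[a,b]}(x)`. -/
noncomputable def marchenkoPastur (y : ℝ) : ℝ → ℝ :=
  Set.indicator (Set.Icc (edgeLeft y) (edgeRight y)) fun x =>
    1 / (2 * Real.pi * x * y) * √((edgeRight y - x) * (x - edgeLeft y))

/-- Condition C1 with exponent `C₀ ≥ 2` for a sequence of random `p(n) × n` matrices
`M n = (ζ_{ij})`, each on its own probability space: the entries are random variables which, for
each `n`, are jointly independent, have mean zero and variance one, and their absolute moments of
order `C₀` are bounded by a constant independent of `n`, `i`, `j`. -/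
structure ConditionC1 {Ω : ℕ → Type*} [∀ n, MeasurableSpace (Ω n)]
    (P : ∀ n, Measure (Ω n)) (p : ℕ → ℕ)
    (M : ∀ n, Ω n → Matrix (Fin (p n)) (Fin n) ℂ) (C₀ : ℝ) : Prop where
  two_le : 2 ≤ C₀
  measurable : ∀ n i j, Measurable fun ω => M n ω i j
  indep : ∀ n, iIndepFun (fun (ij : Fin (p n) × Fin n) (ω : Ω n) => M n ω ij.1 ij.2) (P n)
  mean_zero : ∀ n i j, ∫ ω, M n ω i j ∂(P n) = 0
  variance_one : ∀ n i j, ∫ ω, ‖M n ω i j‖ ^ 2 ∂(P n) = 1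
  moment_bound : ∃ C : ℝ≥0, ∀ n i j, ∫⁻ ω, ‖M n ω i j‖ₑ ^ C₀ ∂(P n) ≤ C

end RandomCovariance

/-!
# The Marchenko-Pastur law on intervals, with overwhelming probability

The error allowed in the theorem is `δ p`, not `δ p |I|`, so Stieltjes transforms at a fixed
distance from the real axis suffice. Let `h(z) = (1/n) tr (W - z)⁻¹`, the trivial eigenvalues
included; they do not meet intervals in `[a + ε, b - ε]`, since `a ≥ 0`.

*Self-consistent equation.* `W` is a sum of rank-one matrices, one for each row `x_i`. Put
`q_i = (1/n) x_i (W_i - z)⁻¹ x_i*`, where `W_i` omits the row `i`. The rank-one update formula for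
resolvents gives the exact identity
`z h² + (z + 1 - p/n) h + 1 = (1/n) ∑ᵢ (q_i - h) / (1 + q_i)` (`stieltjes_quadratic`). Here
`|1 + q_i| ≥ Im z / |z|` because `W_i ≥ 0`, and `q_i` concentrates around `(1/n) tr (W_i - z)⁻¹`
with variance `O(K² / n)`, because `x_i` is independent of `W_i`
(`lintegral_rowForm_sub_stieltjes_le`). The length condition on `I` forces
`K² / n = O(1 / log²⁰ n)`, so the right-hand side tends to zero in mean
(`integral_norm_quadratic_le`).

*Stability.* For `t` in the bulk, the equation `t h² + (t + 1 - y) h + 1 = 0` has two conjugate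
roots at a distance bounded below, and the one in the upper half plane has imaginary part
`π y ρ(t)`. Hence `h(t + iη)` is within `O(η)` plus the error of that root
(`norm_sub_limitStieltjes_le`); no Stieltjes transform of the limit law has to be computed.

*From the transform to counts.* The smoothed count `(1/π) ∫_I Im h(t + iη) dt` differs from
`N_I / n` by `O(√η)` times a bound for `Im h` at height `√η` above the two end points of `I`
(`abs_eigenvalueCount_sub_smoothedCount_le`).

*Concentration.* Changing one row changes each `h(z)` by at most `2 / (n Im z)`, whatever the size
of the row. Since the rows are independent, McDiarmid's inequality
(`hasSubgaussianMGF_of_bounded_differences`) shows that the smoothed count and the two values of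
`Im h` deviate from their means by a fixed amount with probability `exp(-c n)`, where `c` does not
depend on `I`.
-/

namespace RandomCovariance

/-! ### Resolvents of Hermitian matrices and rank-one perturbations -/

section Resolvent

variable {ι : Type*} [Fintype ι] [DecidableEq ι]

/-- The resolvent `(A - z)⁻¹` of a square complex matrix. -/
noncomputable def resolventMatrix (z : ℂ) (A : Matrix ι ι ℂ) : Matrix ι ι ℂ :=
  (A - z • (1 : Matrix ι ι ℂ))⁻¹

lemma ofReal_sub_ne_zero {z : ℂ} (hz : 0 < z.im) (x : ℝ) : (x : ℂ) - z ≠ 0 := by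
  intro h
  have := congrArg Complex.im h
  simp at this
  exact hz.ne' this

lemma sub_smul_mul_spectral {A : Matrix ι ι ℂ} (hA : A.IsHermitian) {z : ℂ} (hz : 0 < z.im) :
    (A - z • (1 : Matrix ι ι ℂ)) * ((hA.eigenvectorUnitary : Matrix ι ι ℂ) *
      Matrix.diagonal (fun k => ((hA.eigenvalues k : ℂ) - z)⁻¹) *
      star (hA.eigenvectorUnitary : Matrix ι ι ℂ)) = 1 := by
  set U : Matrix ι ι ℂ := (hA.eigenvectorUnitary : Matrix ι ι ℂ) with hU
  have hUU : U * star U = 1 := Unitary.coe_mul_star_self hA.eigenvectorUnitary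
  have hUU' : star U * U = 1 := Unitary.coe_star_mul_self hA.eigenvectorUnitary
  have hs : A = U * Matrix.diagonal (fun k => (hA.eigenvalues k : ℂ)) * star U := by
    have := hA.spectral_theorem
    rw [Unitary.conjStarAlgAut_apply] at this
    exact this
  have h1 : A - z • (1 : Matrix ι ι ℂ) =
      U * Matrix.diagonal (fun k => (hA.eigenvalues k : ℂ) - z) * star U := by
    have h2 : Matrix.diagonal (fun k => (hA.eigenvalues k : ℂ) - z) =
        Matrix.diagonal (fun k => (hA.eigenvalues k : ℂ)) - z • (1 : Matrix ι ι ℂ) := by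
      ext i j
      by_cases h : i = j <;> simp [h]
    rw [h2, Matrix.mul_sub, Matrix.sub_mul, ← hs]
    simp [hUU]
  rw [h1]
  calc _ = U * (Matrix.diagonal (fun k => (hA.eigenvalues k : ℂ) - z) * ((star U * U) *
        Matrix.diagonal (fun k => ((hA.eigenvalues k : ℂ) - z)⁻¹))) * star U := by
        simp only [Matrix.mul_assoc]
    _ = 1 := by
        rw [hUU', Matrix.one_mul, Matrix.diagonal_mul_diagonal]
        have : (fun k => ((hA.eigenvalues k : ℂ) - z) * ((hA.eigenvalues k : ℂ) - z)⁻¹) =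
            fun _ => 1 := by
          funext k
          exact mul_inv_cancel₀ (ofReal_sub_ne_zero hz _)
        rw [this, Matrix.diagonal_one, Matrix.mul_one, hUU]

lemma resolventMatrix_eq_spectral {A : Matrix ι ι ℂ} (hA : A.IsHermitian) {z : ℂ}
    (hz : 0 < z.im) :
    resolventMatrix z A = (hA.eigenvectorUnitary : Matrix ι ι ℂ) *
      Matrix.diagonal (fun k => ((hA.eigenvalues k : ℂ) - z)⁻¹) *
      star (hA.eigenvectorUnitary : Matrix ι ι ℂ) :=
  Matrix.inv_eq_right_inv (sub_smul_mul_spectral hA hz)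

lemma sub_smul_mul_resolventMatrix {A : Matrix ι ι ℂ} (hA : A.IsHermitian) {z : ℂ}
    (hz : 0 < z.im) : (A - z • (1 : Matrix ι ι ℂ)) * resolventMatrix z A = 1 := by
  rw [resolventMatrix_eq_spectral hA hz, sub_smul_mul_spectral hA hz]

lemma resolventMatrix_mul_sub_smul {A : Matrix ι ι ℂ} (hA : A.IsHermitian) {z : ℂ}
    (hz : 0 < z.im) : resolventMatrix z A * (A - z • (1 : Matrix ι ι ℂ)) = 1 :=
  mul_eq_one_comm.mp (sub_smul_mul_resolventMatrix hA hz)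

lemma trace_resolventMatrix {A : Matrix ι ι ℂ} (hA : A.IsHermitian) {z : ℂ} (hz : 0 < z.im) :
    (resolventMatrix z A).trace = ∑ k, ((hA.eigenvalues k : ℂ) - z)⁻¹ := by
  rw [resolventMatrix_eq_spectral hA hz, Matrix.trace_mul_comm, ← Matrix.mul_assoc,
    Unitary.coe_star_mul_self, Matrix.one_mul, Matrix.trace_diagonal]

/-- The spectral weight `|⟨u_k, v⟩|²` of a vector `v` on the `k`-th eigenvector of `A`. -/
noncomputable def spectralWeight {A : Matrix ι ι ℂ} (hA : A.IsHermitian) (v : ι → ℂ) (k : ι) : ℝ :=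
  ‖(star (hA.eigenvectorUnitary : Matrix ι ι ℂ) *ᵥ v) k‖ ^ 2

lemma spectralWeight_nonneg {A : Matrix ι ι ℂ} (hA : A.IsHermitian) (v : ι → ℂ) (k : ι) :
    0 ≤ spectralWeight hA v k := by
  unfold spectralWeight; positivity

lemma star_dotProduct_spectral {A : Matrix ι ι ℂ} (hA : A.IsHermitian) (v : ι → ℂ) (d : ι → ℂ) :
    star v ⬝ᵥ (((hA.eigenvectorUnitary : Matrix ι ι ℂ) * Matrix.diagonal d *
      star (hA.eigenvectorUnitary : Matrix ι ι ℂ)) *ᵥ v) =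
      ∑ k, (spectralWeight hA v k : ℂ) * d k := by
  set U : Matrix ι ι ℂ := (hA.eigenvectorUnitary : Matrix ι ι ℂ) with hU
  have h1 : star v ᵥ* U = star (star U *ᵥ v) := by
    rw [Matrix.star_mulVec, Matrix.star_eq_conjTranspose, Matrix.conjTranspose_conjTranspose]
  rw [← Matrix.mulVec_mulVec, ← Matrix.mulVec_mulVec, Matrix.dotProduct_mulVec, h1]
  unfold dotProduct spectralWeight
  refine Finset.sum_congr rfl fun k _ => ?_
  rw [Matrix.mulVec_diagonal, ← hU]
  simp only [Pi.star_apply]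
  have := Complex.conj_mul' ((star U *ᵥ v) k)
  rw [mul_left_comm, mul_comm]
  push_cast
  rw [← this]
  rfl

lemma star_dotProduct_resolventMatrix {A : Matrix ι ι ℂ} (hA : A.IsHermitian) {z : ℂ}
    (hz : 0 < z.im) (v : ι → ℂ) :
    star v ⬝ᵥ (resolventMatrix z A *ᵥ v) =
      ∑ k, (spectralWeight hA v k : ℂ) * ((hA.eigenvalues k : ℂ) - z)⁻¹ := by
  rw [resolventMatrix_eq_spectral hA hz, star_dotProduct_spectral]

lemma star_dotProduct_resolventMatrix_sq {A : Matrix ι ι ℂ} (hA : A.IsHermitian) {z : ℂ}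
    (hz : 0 < z.im) (v : ι → ℂ) :
    star v ⬝ᵥ ((resolventMatrix z A * resolventMatrix z A) *ᵥ v) =
      ∑ k, (spectralWeight hA v k : ℂ) * (((hA.eigenvalues k : ℂ) - z)⁻¹ ^ 2) := by
  rw [← star_dotProduct_spectral, resolventMatrix_eq_spectral hA hz]
  congr 2
  set U : Matrix ι ι ℂ := (hA.eigenvectorUnitary : Matrix ι ι ℂ) with hU
  have hUU' : star U * U = 1 := Unitary.coe_star_mul_self hA.eigenvectorUnitary
  set D := Matrix.diagonal (fun k => ((hA.eigenvalues k : ℂ) - z)⁻¹) with hD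
  calc U * D * star U * (U * D * star U) = U * (D * ((star U * U) * D)) * star U := by
        simp only [Matrix.mul_assoc]
    _ = _ := by
        rw [hUU', Matrix.one_mul, hD, Matrix.diagonal_mul_diagonal]
        simp only [sq]

lemma im_inv_ofReal_sub (x : ℝ) (z : ℂ) :
    ((x : ℂ) - z)⁻¹.im = z.im * ‖((x : ℂ) - z)⁻¹‖ ^ 2 := by
  rw [Complex.inv_im, norm_inv, inv_pow, ← Complex.normSq_eq_norm_sq]
  simp [div_eq_mul_inv]

lemma im_star_dotProduct_resolventMatrix {A : Matrix ι ι ℂ} (hA : A.IsHermitian) {z : ℂ}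
    (hz : 0 < z.im) (v : ι → ℂ) :
    (star v ⬝ᵥ (resolventMatrix z A *ᵥ v)).im =
      z.im * ∑ k, spectralWeight hA v k * ‖((hA.eigenvalues k : ℂ) - z)⁻¹‖ ^ 2 := by
  rw [star_dotProduct_resolventMatrix hA hz, Complex.im_sum, Finset.mul_sum]
  refine Finset.sum_congr rfl fun k _ => ?_
  rw [Complex.im_ofReal_mul, im_inv_ofReal_sub]
  ring

/-- `|v* R² v| ≤ Im (v* R v) / Im z`. -/
lemma norm_star_dotProduct_resolventMatrix_sq_le {A : Matrix ι ι ℂ} (hA : A.IsHermitian) {z : ℂ}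
    (hz : 0 < z.im) (v : ι → ℂ) :
    z.im * ‖star v ⬝ᵥ ((resolventMatrix z A * resolventMatrix z A) *ᵥ v)‖ ≤
      (star v ⬝ᵥ (resolventMatrix z A *ᵥ v)).im := by
  rw [im_star_dotProduct_resolventMatrix hA hz, star_dotProduct_resolventMatrix_sq hA hz]
  refine mul_le_mul_of_nonneg_left ?_ hz.le
  refine (norm_sum_le _ _).trans (Finset.sum_le_sum fun k _ => ?_)
  rw [norm_mul, norm_pow, Complex.norm_real, Real.norm_of_nonneg (spectralWeight_nonneg hA v k)]

/-- The map `z ↦ z / (x - z)` preserves the upper half plane, since it equals `x / (x - z) - 1`. -/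
lemma im_mul_inv_nonneg {x : ℝ} (hx : 0 ≤ x) {z : ℂ} (hz : 0 < z.im) :
    0 ≤ (z * ((x : ℂ) - z)⁻¹).im := by
  have h : z * ((x : ℂ) - z)⁻¹ = x * ((x : ℂ) - z)⁻¹ - 1 := by
    have := ofReal_sub_ne_zero hz x
    field_simp
    ring
  rw [h, Complex.sub_im, Complex.im_ofReal_mul, im_inv_ofReal_sub]
  simp
  positivity

/-- For positive semidefinite `A`, the function `z ↦ z · v* (A - z)⁻¹ v` maps the upper half plane
into itself, which keeps `1 + c v* (A - z)⁻¹ v` away from zero. -/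
lemma im_le_norm_mul_one_add {A : Matrix ι ι ℂ} (hA : A.IsHermitian)
    (hA0 : ∀ k, 0 ≤ hA.eigenvalues k) {z : ℂ} (hz : 0 < z.im) (v : ι → ℂ) {c : ℝ} (hc : 0 ≤ c) :
    z.im ≤ ‖z‖ * ‖1 + c * (star v ⬝ᵥ (resolventMatrix z A *ᵥ v))‖ := by
  rw [← norm_mul]
  refine le_trans ?_ ((le_abs_self _).trans (Complex.abs_im_le_norm _))
  rw [star_dotProduct_resolventMatrix hA hz, mul_add, mul_one, Complex.add_im, mul_left_comm,
    Complex.im_ofReal_mul, Finset.mul_sum, Complex.im_sum]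
  have : 0 ≤ c * ∑ i, (z * ((spectralWeight hA v i : ℂ) *
      ((hA.eigenvalues i : ℂ) - z)⁻¹)).im := by
    refine mul_nonneg hc (Finset.sum_nonneg fun k _ => ?_)
    rw [mul_left_comm, Complex.im_ofReal_mul]
    exact mul_nonneg (spectralWeight_nonneg _ _ _) (im_mul_inv_nonneg (hA0 k) hz)
  linarith

lemma norm_inv_ofReal_sub_le {z : ℂ} (hz : 0 < z.im) (x : ℝ) :
    ‖((x : ℂ) - z)⁻¹‖ ≤ z.im⁻¹ := by
  rw [norm_inv]
  refine inv_anti₀ hz ?_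
  have := Complex.abs_im_le_norm ((x : ℂ) - z)
  simp at this
  exact (le_abs_self _).trans this

/-- The Frobenius norm of the resolvent is controlled by its trace, hence by `Im z`. -/
lemma sum_norm_sq_resolventMatrix_le {A : Matrix ι ι ℂ} (hA : A.IsHermitian) {z : ℂ}
    (hz : 0 < z.im) :
    ∑ i, ∑ j, ‖resolventMatrix z A i j‖ ^ 2 ≤ Fintype.card ι * (z.im⁻¹) ^ 2 := by
  have h1 : ((∑ i, ∑ j, ‖resolventMatrix z A i j‖ ^ 2 : ℝ) : ℂ) =
      (resolventMatrix z A * (resolventMatrix z A)ᴴ).trace := by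
    simp only [Matrix.trace, Matrix.diag, Matrix.mul_apply, Matrix.conjTranspose_apply]
    push_cast
    refine Finset.sum_congr rfl fun i _ => Finset.sum_congr rfl fun j _ => ?_
    exact (Complex.mul_conj' _).symm
  have h2 : (resolventMatrix z A * (resolventMatrix z A)ᴴ).trace =
      ((∑ k, ‖((hA.eigenvalues k : ℂ) - z)⁻¹‖ ^ 2 : ℝ) : ℂ) := by
    rw [resolventMatrix_eq_spectral hA hz]
    set U : Matrix ι ι ℂ := (hA.eigenvectorUnitary : Matrix ι ι ℂ) with hU
    have hUU' : star U * U = 1 := Unitary.coe_star_mul_self hA.eigenvectorUnitary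
    set D := Matrix.diagonal (fun k => ((hA.eigenvalues k : ℂ) - z)⁻¹) with hD
    have : (U * D * star U) * (U * D * star U)ᴴ = U * (D * Dᴴ) * star U := by
      rw [Matrix.conjTranspose_mul, Matrix.conjTranspose_mul, Matrix.star_eq_conjTranspose,
        Matrix.conjTranspose_conjTranspose]
      calc _ = U * (D * ((Uᴴ * U) * Dᴴ)) * Uᴴ := by simp only [Matrix.mul_assoc]
        _ = _ := by rw [← Matrix.star_eq_conjTranspose U, hUU', Matrix.one_mul]
    rw [this, Matrix.trace_mul_comm, ← Matrix.mul_assoc, hUU', Matrix.one_mul, hD,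
      Matrix.diagonal_conjTranspose, Matrix.diagonal_mul_diagonal, Matrix.trace_diagonal]
    push_cast
    refine Finset.sum_congr rfl fun k _ => ?_
    exact Complex.mul_conj' _
  have h3 : ∑ i, ∑ j, ‖resolventMatrix z A i j‖ ^ 2 =
      ∑ k, ‖((hA.eigenvalues k : ℂ) - z)⁻¹‖ ^ 2 := by
    exact_mod_cast h1.trans h2
  rw [h3]
  calc _ ≤ ∑ _k : ι, (z.im⁻¹) ^ 2 :=
        Finset.sum_le_sum fun k _ => pow_le_pow_left₀ (norm_nonneg _)
          (norm_inv_ofReal_sub_le hz _) 2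
    _ = _ := by simp

/-- The resolvent identity for `A' = A + c v v*`. -/
lemma resolventMatrix_rank_one {A A' : Matrix ι ι ℂ} (hA : A.IsHermitian) (hA' : A'.IsHermitian)
    {z : ℂ} (hz : 0 < z.im) (v : ι → ℂ) (c : ℝ)
    (hAA' : A' = A + (c : ℂ) • Matrix.vecMulVec v (star v)) :
    resolventMatrix z A = resolventMatrix z A' + (c : ℂ) • (resolventMatrix z A' *
      (Matrix.vecMulVec v (star v) * resolventMatrix z A)) := by
  set R := resolventMatrix z A
  set R' := resolventMatrix z A'
  have h1 : (A' - z • (1 : Matrix ι ι ℂ)) * R =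
      1 + (c : ℂ) • (Matrix.vecMulVec v (star v) * R) := by
    rw [hAA', add_sub_right_comm, Matrix.add_mul, sub_smul_mul_resolventMatrix hA hz]
    simp
  have : R' * ((A' - z • (1 : Matrix ι ι ℂ)) * R) = R := by
    rw [← Matrix.mul_assoc, resolventMatrix_mul_sub_smul hA' hz, Matrix.one_mul]
  rw [h1, Matrix.mul_add, Matrix.mul_one] at this
  simpa using this.symm

lemma resolventMatrix_rank_one_mulVec {A A' : Matrix ι ι ℂ} (hA : A.IsHermitian)
    (hA' : A'.IsHermitian) {z : ℂ} (hz : 0 < z.im) (v : ι → ℂ) (c : ℝ)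
    (hAA' : A' = A + (c : ℂ) • Matrix.vecMulVec v (star v)) :
    (1 + c * (star v ⬝ᵥ (resolventMatrix z A *ᵥ v))) • (resolventMatrix z A' *ᵥ v) =
      resolventMatrix z A *ᵥ v := by
  have h2 := resolventMatrix_rank_one hA hA' hz v c hAA'
  set R := resolventMatrix z A
  set R' := resolventMatrix z A'
  have h3 : R *ᵥ v = R' *ᵥ v + ((c : ℂ) * (star v ⬝ᵥ (R *ᵥ v))) • (R' *ᵥ v) := by
    conv_lhs => rw [h2]
    rw [Matrix.add_mulVec, Matrix.smul_mulVec, ← Matrix.mulVec_mulVec, ← Matrix.mulVec_mulVec,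
      Matrix.vecMulVec_mulVec]
    congr 1
    rw [mul_smul]
    congr 1
    simp [Matrix.mulVec_smul]
  rw [add_smul, one_smul, ← h3]

lemma star_dotProduct_resolventMatrix_rank_one {A A' : Matrix ι ι ℂ} (hA : A.IsHermitian)
    (hA' : A'.IsHermitian) {z : ℂ} (hz : 0 < z.im) (v : ι → ℂ) (c : ℝ)
    (hAA' : A' = A + (c : ℂ) • Matrix.vecMulVec v (star v)) :
    (1 + c * (star v ⬝ᵥ (resolventMatrix z A *ᵥ v))) * (star v ⬝ᵥ (resolventMatrix z A' *ᵥ v)) =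
      star v ⬝ᵥ (resolventMatrix z A *ᵥ v) := by
  conv_rhs => rw [← resolventMatrix_rank_one_mulVec hA hA' hz v c hAA']
  rw [dotProduct_smul, smul_eq_mul]

/-- The Sherman-Morrison formula at the level of traces, cleared of denominators. -/
lemma trace_resolventMatrix_sub_mul {A A' : Matrix ι ι ℂ} (hA : A.IsHermitian)
    (hA' : A'.IsHermitian) {z : ℂ} (hz : 0 < z.im) (v : ι → ℂ) (c : ℝ)
    (hAA' : A' = A + (c : ℂ) • Matrix.vecMulVec v (star v)) :
    ((resolventMatrix z A).trace - (resolventMatrix z A').trace) *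
      (1 + c * (star v ⬝ᵥ (resolventMatrix z A *ᵥ v))) =
      c * (star v ⬝ᵥ ((resolventMatrix z A * resolventMatrix z A) *ᵥ v)) := by
  have key := resolventMatrix_rank_one_mulVec hA hA' hz v c hAA'
  have h2 := resolventMatrix_rank_one hA hA' hz v c hAA'
  set R := resolventMatrix z A
  set R' := resolventMatrix z A'
  have h3 : R.trace - R'.trace = c * (star v ⬝ᵥ ((R * R') *ᵥ v)) := by
    have h4 : R.trace = R'.trace + c * (R' * (Matrix.vecMulVec v (star v) * R)).trace := by
      conv_lhs => rw [h2]
      simp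
    rw [h4, add_sub_cancel_left, ← Matrix.mul_assoc, Matrix.trace_mul_cycle, Matrix.mul_vecMulVec,
      Matrix.trace_vecMulVec, dotProduct_comm]
  rw [h3, mul_assoc]
  congr 1
  rw [← Matrix.mulVec_mulVec, ← Matrix.mulVec_mulVec]
  conv_rhs => rw [← key]
  rw [Matrix.mulVec_smul, dotProduct_smul, smul_eq_mul, mul_comm]

/-- A positive rank-one perturbation moves the trace of the resolvent by at most `1 / Im z`,
whatever its size. -/
lemma norm_trace_resolventMatrix_sub_le {A A' : Matrix ι ι ℂ} (hA : A.IsHermitian)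
    (hA' : A'.IsHermitian) {z : ℂ} (hz : 0 < z.im) (v : ι → ℂ) {c : ℝ} (hc : 0 ≤ c)
    (hAA' : A' = A + (c : ℂ) • Matrix.vecMulVec v (star v)) :
    ‖(resolventMatrix z A).trace - (resolventMatrix z A').trace‖ ≤ z.im⁻¹ := by
  have h1 := congrArg norm (trace_resolventMatrix_sub_mul hA hA' hz v c hAA')
  have h2 := norm_star_dotProduct_resolventMatrix_sq_le hA hz v
  have h3 := star_dotProduct_resolventMatrix_rank_one hA hA' hz v c hAA'
  set q := star v ⬝ᵥ (resolventMatrix z A *ᵥ v) with hq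
  set T := (resolventMatrix z A).trace - (resolventMatrix z A').trace
  have hne : (1 + c * q : ℂ) ≠ 0 := by
    intro h0
    rw [h0, zero_mul] at h3
    rw [← h3] at h0
    simp at h0
  have h4 : c * q.im ≤ ‖(1 + c * q : ℂ)‖ := by
    have := (le_abs_self _).trans (Complex.abs_im_le_norm (1 + c * q : ℂ))
    simpa using this
  rw [norm_mul, norm_mul, Complex.norm_real, Real.norm_of_nonneg hc] at h1
  have hpos : 0 < ‖(1 + c * q : ℂ)‖ := norm_pos_iff.mpr hne
  rw [← mul_le_mul_iff_left₀ hpos, h1, inv_mul_eq_div, le_div_iff₀ hz]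
  nlinarith [mul_le_mul_of_nonneg_left h2 hc]

end Resolvent
/-! ### The Stieltjes transform of a sample covariance matrix -/

section Stieltjes

variable {p n : ℕ}

/-- The Stieltjes transform `h(z) = (1/n) tr (W - z)⁻¹` of the spectral measure of the `n × n`
matrix `W = (1/n) X* X`, as a function of the tuple `X` of the rows of the matrix. The `n - p`
trivial eigenvalues are included. -/
noncomputable def stieltjes (z : ℂ) (X : Fin p → Fin n → ℂ) : ℂ :=
  (n : ℂ)⁻¹ * (resolventMatrix z (covMatrix (Matrix.of X))).trace

lemma covMatrix_apply (M : Matrix (Fin p) (Fin n) ℂ) (a b : Fin n) :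
    covMatrix M a b = (n : ℂ)⁻¹ * ∑ k, star (M k a) * M k b := by
  simp [covMatrix, Matrix.mul_apply]

lemma covMatrix_eq_update_add (X : Fin p → Fin n → ℂ) (i : Fin p) :
    covMatrix (Matrix.of X) = covMatrix (Matrix.of (Function.update X i 0)) +
      (((n : ℝ)⁻¹ : ℝ) : ℂ) • Matrix.vecMulVec (star (X i)) (star (star (X i))) := by
  ext a b
  simp only [covMatrix_apply, Matrix.add_apply, Matrix.smul_apply, Matrix.vecMulVec_apply,
    Matrix.of_apply, smul_eq_mul, Pi.star_apply, star_star]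
  push_cast
  rw [← mul_add]
  congr 1
  rw [← Finset.add_sum_erase _ _ (Finset.mem_univ i),
    ← Finset.add_sum_erase (Finset.univ) (fun k => star (Function.update X i 0 k a) *
      Function.update X i 0 k b) (Finset.mem_univ i)]
  simp only [Function.update_self, Pi.zero_apply, mul_zero, zero_add]
  rw [add_comm]
  congr 1
  refine Finset.sum_congr rfl fun k hk => ?_
  rw [Function.update_of_ne (Finset.ne_of_mem_erase hk)]

lemma covMatrix_eq_sum (X : Fin p → Fin n → ℂ) :
    covMatrix (Matrix.of X) =
      ∑ i, (((n : ℝ)⁻¹ : ℝ) : ℂ) • Matrix.vecMulVec (star (X i)) (star (star (X i))) := by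
  ext a b
  simp only [covMatrix_apply, Matrix.sum_apply, Matrix.smul_apply, Matrix.vecMulVec_apply,
    Matrix.of_apply, smul_eq_mul, Pi.star_apply, star_star, Finset.mul_sum]
  push_cast
  rfl

open scoped ComplexOrder in
lemma covMatrix_eigenvalues_nonneg (M : Matrix (Fin p) (Fin n) ℂ) (k : Fin n) :
    0 ≤ (covMatrix_isHermitian M).eigenvalues k := by
  have h : (covMatrix M).PosSemidef := by
    unfold covMatrix
    exact (Matrix.posSemidef_conjTranspose_mul_self M).smul (by positivity)
  exact h.eigenvalues_nonneg k

lemma stieltjes_eq_sum {z : ℂ} (hz : 0 < z.im) (X : Fin p → Fin n → ℂ) :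
    stieltjes z X = (n : ℂ)⁻¹ *
      ∑ k, (((covMatrix_isHermitian (Matrix.of X)).eigenvalues k : ℂ) - z)⁻¹ := by
  rw [stieltjes, trace_resolventMatrix _ hz]

lemma stieltjes_im_nonneg {z : ℂ} (hz : 0 < z.im) (X : Fin p → Fin n → ℂ) :
    0 ≤ (stieltjes z X).im := by
  rw [stieltjes_eq_sum hz, ← Complex.ofReal_natCast, ← Complex.ofReal_inv, Complex.im_ofReal_mul,
    Complex.im_sum]
  refine mul_nonneg (by positivity) (Finset.sum_nonneg fun k _ => ?_)
  rw [im_inv_ofReal_sub]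
  positivity

lemma norm_stieltjes_le {z : ℂ} (hz : 0 < z.im) (X : Fin p → Fin n → ℂ) :
    ‖stieltjes z X‖ ≤ z.im⁻¹ := by
  rw [stieltjes_eq_sum hz, norm_mul, norm_inv, Complex.norm_natCast]
  rcases Nat.eq_zero_or_pos n with rfl | hn
  · simp [hz.le]
  rw [inv_mul_le_iff₀ (by exact_mod_cast hn)]
  refine (norm_sum_le _ _).trans ((Finset.sum_le_sum fun k _ =>
    norm_inv_ofReal_sub_le hz _).trans ?_)
  simp

/-- The quadratic form `q_i = (1/n) x_i (W_i - z)⁻¹ x_i*`, where `x_i` is the `i`-th row and `W_i`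
is the covariance matrix with that row removed. -/
noncomputable def rowForm (z : ℂ) (X : Fin p → Fin n → ℂ) (i : Fin p) : ℂ :=
  (((n : ℝ)⁻¹ : ℝ) : ℂ) * (star (star (X i)) ⬝ᵥ
    (resolventMatrix z (covMatrix (Matrix.of (Function.update X i 0))) *ᵥ star (X i)))

lemma norm_stieltjes_sub_update_zero_le {z : ℂ} (hz : 0 < z.im) (X : Fin p → Fin n → ℂ)
    (i : Fin p) : ‖stieltjes z X - stieltjes z (Function.update X i 0)‖ ≤ (n * z.im)⁻¹ := by
  rw [norm_sub_rev, stieltjes, stieltjes, ← mul_sub, norm_mul, norm_inv, Complex.norm_natCast,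
    mul_inv]
  refine mul_le_mul_of_nonneg_left ?_ (by positivity)
  exact norm_trace_resolventMatrix_sub_le (covMatrix_isHermitian _) (covMatrix_isHermitian _) hz
    (star (X i)) (by positivity) (covMatrix_eq_update_add X i)

/-- Replacing one row changes the Stieltjes transform by at most `2 / (n Im z)`. -/
lemma norm_stieltjes_sub_update_le {z : ℂ} (hz : 0 < z.im) (X : Fin p → Fin n → ℂ)
    (i : Fin p) (x : Fin n → ℂ) :
    ‖stieltjes z X - stieltjes z (Function.update X i x)‖ ≤ 2 * (n * z.im)⁻¹ := by
  have h1 := norm_stieltjes_sub_update_zero_le hz X i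
  have h2 := norm_stieltjes_sub_update_zero_le hz (Function.update X i x) i
  rw [Function.update_idem, norm_sub_rev] at h2
  have := norm_add_le (stieltjes z X - stieltjes z (Function.update X i 0))
    (stieltjes z (Function.update X i 0) - stieltjes z (Function.update X i x))
  rw [sub_add_sub_cancel] at this
  linarith

lemma im_le_norm_mul_one_add_rowForm {z : ℂ} (hz : 0 < z.im) (X : Fin p → Fin n → ℂ)
    (i : Fin p) : z.im ≤ ‖z‖ * ‖1 + rowForm z X i‖ :=
  im_le_norm_mul_one_add (covMatrix_isHermitian _) (covMatrix_eigenvalues_nonneg _) hz _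
    (by positivity)

lemma one_add_rowForm_ne_zero {z : ℂ} (hz : 0 < z.im) (X : Fin p → Fin n → ℂ)
    (i : Fin p) : 1 + rowForm z X i ≠ 0 := by
  intro h
  have := im_le_norm_mul_one_add_rowForm hz X i
  rw [h] at this
  simp at this
  linarith

/-- The identity `n + z tr R = tr (W R)` for `R = (W - z)⁻¹`, with the right-hand side expanded over
the rows. -/
lemma one_add_mul_stieltjes {z : ℂ} (hz : 0 < z.im) (hn : 0 < n) (X : Fin p → Fin n → ℂ) :
    1 + z * stieltjes z X = (n : ℂ)⁻¹ * ∑ i, rowForm z X i / (1 + rowForm z X i) := by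
  have hn' : (n : ℂ) ≠ 0 := by exact_mod_cast hn.ne'
  set W := covMatrix (Matrix.of X) with hW
  set R := resolventMatrix z W with hR
  have h1 : (W * R).trace = n + z * R.trace := by
    have h := sub_smul_mul_resolventMatrix (covMatrix_isHermitian (Matrix.of X)) hz
    rw [Matrix.sub_mul, sub_eq_iff_eq_add] at h
    rw [hW, hR, hW, h]
    simp
  have h2 : (W * R).trace = ∑ i, rowForm z X i / (1 + rowForm z X i) := by
    rw [hW, covMatrix_eq_sum, Finset.sum_mul, Matrix.trace_sum]
    refine Finset.sum_congr rfl fun i _ => ?_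
    have h4 := star_dotProduct_resolventMatrix_rank_one (covMatrix_isHermitian
      (Matrix.of (Function.update X i 0))) (covMatrix_isHermitian (Matrix.of X)) hz (star (X i))
      _ (covMatrix_eq_update_add X i)
    rw [eq_div_iff (one_add_rowForm_ne_zero hz X i)]
    have h3 : ((((n : ℝ)⁻¹ : ℝ) : ℂ) • Matrix.vecMulVec (star (X i)) (star (star (X i))) *
        R).trace = (((n : ℝ)⁻¹ : ℝ) : ℂ) * (star (star (X i)) ⬝ᵥ R *ᵥ star (X i)) := by
      rw [Matrix.smul_mul, Matrix.trace_smul, smul_eq_mul, Matrix.vecMulVec_mul,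
        Matrix.trace_vecMulVec, dotProduct_comm, Matrix.dotProduct_mulVec]
    rw [h3, hR, hW]
    conv_rhs => rw [rowForm, ← h4]
    rw [rowForm]
    ring
  rw [← h2, h1, stieltjes]
  field_simp
  rfl

/-- The approximate quadratic equation of the Stieltjes transform, with its exact error term. -/
lemma stieltjes_quadratic {z : ℂ} (hz : 0 < z.im) (hn : 0 < n) (X : Fin p → Fin n → ℂ) :
    z * stieltjes z X ^ 2 + (z + 1 - (p / n : ℝ)) * stieltjes z X + 1 =
      (n : ℂ)⁻¹ * ∑ i, (rowForm z X i - stieltjes z X) / (1 + rowForm z X i) := by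
  have h1 := one_add_mul_stieltjes hz hn X
  have h2 : ∑ i, (rowForm z X i - stieltjes z X) / (1 + rowForm z X i) =
      (∑ i, rowForm z X i / (1 + rowForm z X i)) * (1 + stieltjes z X) - p * stieltjes z X := by
    have h3 : (p : ℂ) * stieltjes z X = ∑ _i : Fin p, stieltjes z X := by simp
    rw [h3, Finset.sum_mul, ← Finset.sum_sub_distrib]
    refine Finset.sum_congr rfl fun i _ => ?_
    have := one_add_rowForm_ne_zero hz X i
    field_simp
    ring
  rw [h2, mul_sub, ← mul_assoc, ← h1]
  push_cast
  ring

/-- The error in the quadratic equation is controlled by the fluctuations of the quadratic forms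
`q_i` around the normalized traces of the resolvents in which the row `i` is removed. -/
lemma norm_stieltjes_quadratic_le {z : ℂ} (hz : 0 < z.im) (hn : 0 < n) (X : Fin p → Fin n → ℂ) :
    ‖z * stieltjes z X ^ 2 + (z + 1 - (p / n : ℝ)) * stieltjes z X + 1‖ ≤
      (n : ℝ)⁻¹ * ∑ i, (‖z‖ / z.im) * (‖rowForm z X i - stieltjes z (Function.update X i 0)‖ +
        (n * z.im)⁻¹) := by
  rw [stieltjes_quadratic hz hn, norm_mul, norm_inv, Complex.norm_natCast]
  refine mul_le_mul_of_nonneg_left ?_ (by positivity)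
  refine (norm_sum_le _ _).trans (Finset.sum_le_sum fun i _ => ?_)
  have h1 := im_le_norm_mul_one_add_rowForm hz X i
  have h2 := norm_stieltjes_sub_update_zero_le hz X i
  have h3 : ‖rowForm z X i - stieltjes z X‖ ≤
      ‖rowForm z X i - stieltjes z (Function.update X i 0)‖ + (n * z.im)⁻¹ := by
    have := norm_sub_le (rowForm z X i - stieltjes z (Function.update X i 0))
      (stieltjes z X - stieltjes z (Function.update X i 0))
    rw [sub_sub_sub_cancel_right] at this
    linarith
  rw [norm_div, div_eq_inv_mul]
  refine mul_le_mul ?_ h3 (norm_nonneg _) (by positivity)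
  have hpos := norm_pos_iff.mpr (one_add_rowForm_ne_zero hz X i)
  rw [inv_eq_one_div, div_le_div_iff₀ hpos hz]
  linarith

lemma continuous_matrix_inv {α : Type*} [TopologicalSpace α] {B : α → Matrix (Fin n) (Fin n) ℂ}
    (hB : Continuous B) (hdet : ∀ q, (B q).det ≠ 0) : Continuous fun q => (B q)⁻¹ := by
  have : (fun q => (B q)⁻¹) = fun q => (B q).det⁻¹ • (B q).adjugate := by
    funext q
    rw [Matrix.inv_def, Ring.inverse_eq_inv']
  rw [this]
  exact (hB.matrix_det.inv₀ hdet).smul hB.matrix_adjugate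

lemma continuous_covMatrix : Continuous fun X : Fin p → Fin n → ℂ => covMatrix (Matrix.of X) := by
  refine continuous_matrix fun a b => ?_
  simp only [covMatrix_apply, Matrix.of_apply]
  fun_prop

lemma continuous_resolventMatrix_covMatrix {η : ℝ} (hη : 0 < η) :
    Continuous fun q : ℝ × (Fin p → Fin n → ℂ) =>
      resolventMatrix (q.1 + η * Complex.I) (covMatrix (Matrix.of q.2)) := by
  refine continuous_matrix_inv ?_ fun q h0 => ?_
  · have h := (continuous_covMatrix (p := p) (n := n)).comp
      (continuous_snd : Continuous fun q : ℝ × (Fin p → Fin n → ℂ) => q.2)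
    refine continuous_matrix fun a b => ?_
    have hab := h.matrix_elem a b
    simp only [Function.comp_apply] at hab
    simp only [Matrix.sub_apply, Matrix.smul_apply, smul_eq_mul]
    fun_prop
  · have h := sub_smul_mul_resolventMatrix (covMatrix_isHermitian (Matrix.of q.2))
      (z := (q.1 : ℂ) + η * Complex.I) (by simpa using hη)
    have := congrArg Matrix.det h
    rw [Matrix.det_mul, h0] at this
    simp at this

lemma continuous_stieltjes {η : ℝ} (hη : 0 < η) :
    Continuous fun q : ℝ × (Fin p → Fin n → ℂ) => stieltjes (q.1 + η * Complex.I) q.2 := by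
  have h := (continuous_resolventMatrix_covMatrix (p := p) (n := n) hη).matrix_trace
  unfold stieltjes
  exact continuous_const.mul h

lemma continuous_stieltjes_snd (t : ℝ) {η : ℝ} (hη : 0 < η) :
    Continuous fun X : Fin p → Fin n → ℂ => stieltjes (t + η * Complex.I) X := by
  have h : Continuous fun X : Fin p → Fin n → ℂ => (t, X) := by fun_prop
  simpa only [Function.comp_def] using (continuous_stieltjes hη).comp h

end Stieltjes
/-! ### Quadratic forms in independent random variables -/

section QuadraticForm

/-- Two disjoint blocks of an independent family, each extended by zero, are independent. -/
lemma indepFun_zero_extend {Ω ι E : Type*} [MeasurableSpace Ω] {P : Measure Ω} [DecidableEq ι]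
    [Zero E] [MeasurableSpace E] {f : ι → Ω → E} (hf : iIndepFun f P)
    (hm : ∀ i, Measurable (f i)) {S T : Finset ι} (hST : Disjoint S T) :
    IndepFun (fun ω i => if i ∈ S then f i ω else 0) (fun ω i => if i ∈ T then f i ω else 0) P := by
  have key : ∀ S : Finset ι, ∃ φ : (S → E) → (ι → E), Measurable φ ∧
      (fun ω i => if i ∈ S then f i ω else 0) = φ ∘ fun ω (i : S) => f i ω := by
    intro S
    refine ⟨fun x i => if h : i ∈ S then x ⟨i, h⟩ else 0, ?_, ?_⟩
    · refine measurable_pi_lambda _ fun i => ?_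
      by_cases h : i ∈ S
      · simpa [h] using measurable_pi_apply _
      · simp [h]
    · funext ω i
      by_cases h : i ∈ S <;> simp [h]
  obtain ⟨φ, hφ, hφe⟩ := key S
  obtain ⟨ψ, hψ, hψe⟩ := key T
  rw [hφe, hψe]
  exact (hf.indepFun_finset S T hST hm).comp hφ hψ

variable {Ω ι : Type*} [MeasurableSpace Ω] {P : Measure Ω}

/-- A function of the block `s` factors out of the mean of its product with a function of another
variable. -/
lemma integral_dependsOn_mul [DecidableEq ι] {𝕜 : Type*} [RCLike 𝕜] {ξ : ι → Ω → ℂ}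
    (hind : iIndepFun ξ P)
    (hm : ∀ i, Measurable (ξ i)) {s : Finset ι} {a : ι} (ha : a ∉ s) {φ : (ι → ℂ) → 𝕜}
    (hφ : Measurable φ) (hφs : DependsOn φ (s : Set ι)) {ψ : ℂ → 𝕜} (hψ : Measurable ψ) :
    ∫ ω, φ (fun i => ξ i ω) * ψ (ξ a ω) ∂P =
      (∫ ω, φ (fun i => ξ i ω) ∂P) * ∫ ω, ψ (ξ a ω) ∂P := by
  have h1 : ∀ ω, φ (fun i => ξ i ω) = φ (fun i => if i ∈ s then ξ i ω else 0) := by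
    intro ω
    refine hφs fun i hi => ?_
    simp [Finset.mem_coe.mp hi]
  have hi : IndepFun (fun ω i => if i ∈ s then ξ i ω else 0)
      (fun ω i => if i ∈ ({a} : Finset ι) then ξ i ω else 0) P :=
    indepFun_zero_extend hind hm (by simpa using ha)
  have hmeas : ∀ s : Finset ι, Measurable (fun ω i => if i ∈ s then ξ i ω else 0) := by
    intro s
    refine measurable_pi_lambda _ fun i => ?_
    by_cases h : i ∈ s
    · simpa [h] using hm i
    · simp [h]
  rw [integral_congr_ae (ae_of_all _ fun ω => congrArg (· * ψ (ξ a ω)) (h1 ω)),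
    integral_congr_ae (ae_of_all _ h1)]
  have hψa : Measurable fun x : ι → ℂ => ψ (x a) := by fun_prop
  have h3 := hi.integral_fun_comp_mul_comp (f := φ) (g := fun x => ψ (x a))
    (hmeas s).aemeasurable (hmeas _).aemeasurable hφ.aestronglyMeasurable hψa.aestronglyMeasurable
  simpa using h3

lemma memLp_top_mul {f g : Ω → ℂ} (hf : MemLp f ⊤ P) (hg : MemLp g ⊤ P) :
    MemLp (fun ω => f ω * g ω) ⊤ P := hg.mul' hf

lemma memLp_top_star {f : Ω → ℂ} (hf : MemLp f ⊤ P) : MemLp (fun ω => star (f ω)) ⊤ P :=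
  hf.star

lemma integrable_of_memLp_top [IsProbabilityMeasure P] {f : Ω → ℂ} (hf : MemLp f ⊤ P) :
    Integrable f P := hf.integrable le_top

lemma integrable_norm_sq_of_memLp_top [IsProbabilityMeasure P] {f : Ω → ℂ} (hf : MemLp f ⊤ P) :
    Integrable (fun ω => ‖f ω‖ ^ 2) P :=
  (hf.mono_exponent (p := 2) le_top).integrable_norm_pow (by norm_num)

lemma integral_norm_sq_add_of_orthogonal [IsProbabilityMeasure P] {f g : Ω → ℂ}
    (hf : MemLp f ⊤ P) (hg : MemLp g ⊤ P) (h : ∫ ω, f ω * star (g ω) ∂P = 0) :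
    ∫ ω, ‖f ω + g ω‖ ^ 2 ∂P = ∫ ω, ‖f ω‖ ^ 2 ∂P + ∫ ω, ‖g ω‖ ^ 2 ∂P := by
  have hfg : Integrable (fun ω => f ω * star (g ω)) P :=
    integrable_of_memLp_top (memLp_top_mul hf (memLp_top_star hg))
  have h0 : ∫ ω, (f ω * star (g ω)).re ∂P = 0 := by
    have := integral_re hfg
    rw [h] at this
    simpa using this
  have h1 : ∀ ω, ‖f ω + g ω‖ ^ 2 = ‖f ω‖ ^ 2 + ‖g ω‖ ^ 2 + 2 * (f ω * star (g ω)).re := by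
    intro ω
    simp only [← Complex.normSq_eq_norm_sq]
    exact Complex.normSq_add _ _
  simp_rw [h1]
  have hre : Integrable (fun ω => 2 * (f ω * star (g ω)).re) P := hfg.re.const_mul 2
  have hsum : Integrable (fun ω => ‖f ω‖ ^ 2 + ‖g ω‖ ^ 2) P :=
    (integrable_norm_sq_of_memLp_top hf).add (integrable_norm_sq_of_memLp_top hg)
  rw [integral_add hsum hre, integral_add (integrable_norm_sq_of_memLp_top hf)
    (integrable_norm_sq_of_memLp_top hg), integral_const_mul, h0]
  simp

/-- Bounded independent complex random variables with mean zero and variance one. -/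
structure BoundedStandard (ξ : ι → Ω → ℂ) (P : Measure Ω) (K : ℝ) : Prop where
  indep : iIndepFun ξ P
  measurable : ∀ i, Measurable (ξ i)
  mean_zero : ∀ i, ∫ ω, ξ i ω ∂P = 0
  variance_one : ∀ i, ∫ ω, ‖ξ i ω‖ ^ 2 ∂P = 1
  bound : ∀ i, ∀ᵐ ω ∂P, ‖ξ i ω‖ ≤ K

namespace BoundedStandard

variable {ξ : ι → Ω → ℂ} {K : ℝ}

lemma memLp (h : BoundedStandard ξ P K) (i : ι) : MemLp (ξ i) ⊤ P :=
  memLp_top_of_bound (h.measurable i).aestronglyMeasurable K (h.bound i)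

lemma memLp_linear (h : BoundedStandard ξ P K) (b : ι → ℂ) (s : Finset ι) :
    MemLp (fun ω => ∑ l ∈ s, b l * ξ l ω) ⊤ P :=
  memLp_finsetSum _ fun l _ => (h.memLp l).const_mul (b l)

lemma integral_star (h : BoundedStandard ξ P K) (i : ι) : ∫ ω, star (ξ i ω) ∂P = 0 := by
  have : ∫ ω, star (ξ i ω) ∂P = star (∫ ω, ξ i ω ∂P) := integral_conj
  rw [this, h.mean_zero, star_zero]

lemma integral_norm_sq_linear [DecidableEq ι] [IsProbabilityMeasure P]
    (h : BoundedStandard ξ P K) (b : ι → ℂ)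
    (s : Finset ι) : ∫ ω, ‖∑ l ∈ s, b l * ξ l ω‖ ^ 2 ∂P = ∑ l ∈ s, ‖b l‖ ^ 2 := by
  induction s using Finset.induction_on with
  | empty => simp
  | insert a s ha ih =>
    simp_rw [Finset.sum_insert ha, add_comm (b a * _)]
    rw [integral_norm_sq_add_of_orthogonal (h.memLp_linear b s) ((h.memLp a).const_mul (b a)), ih]
    · simp_rw [norm_mul, mul_pow]
      rw [integral_const_mul, h.variance_one, mul_one, add_comm]
    · have e : ∀ ω, (∑ l ∈ s, b l * ξ l ω) * star (b a * ξ a ω) =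
          (∑ l ∈ s, b l * ξ l ω) * star (b a) * star (ξ a ω) := by
        intro ω
        rw [star_mul]
        ring
      simp_rw [e]
      have := integral_dependsOn_mul h.indep h.measurable ha
        (φ := fun x => (∑ l ∈ s, b l * x l) * star (b a)) (ψ := star) (by fun_prop)
        (by
          intro x y hxy
          simp only
          rw [Finset.sum_congr rfl fun l hl => by rw [hxy l hl]])
        (by fun_prop)
      rw [this, h.integral_star, mul_zero]

lemma integral_sq_norm_sq_sub_one_le [IsProbabilityMeasure P] (h : BoundedStandard ξ P K) (a : ι) :
    ∫ ω, ‖((‖ξ a ω‖ ^ 2 - 1 : ℝ) : ℂ)‖ ^ 2 ∂P ≤ K ^ 2 := by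
  -- `(u - 1)² ≤ K² u - 2 u + 1` for `0 ≤ u ≤ K²`, with `u = |ξ|²` of mean one
  have h2 : ∫ ω, ‖((‖ξ a ω‖ ^ 2 - 1 : ℝ) : ℂ)‖ ^ 2 ∂P ≤
      ∫ ω, ((K ^ 2 - 2) * ‖ξ a ω‖ ^ 2 + 1) ∂P := by
    have hi := integrable_norm_sq_of_memLp_top (h.memLp a)
    refine integral_mono_of_nonneg (ae_of_all _ fun ω => by positivity)
      ((hi.const_mul _).add (integrable_const 1)) ?_
    filter_upwards [h.bound a] with ω hω
    rw [Complex.norm_real, Real.norm_eq_abs, sq_abs]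
    have : ‖ξ a ω‖ ^ 2 ≤ K ^ 2 := pow_le_pow_left₀ (norm_nonneg _) hω 2
    nlinarith [mul_le_mul_of_nonneg_right this (sq_nonneg ‖ξ a ω‖)]
  refine h2.trans ?_
  rw [integral_add ((integrable_norm_sq_of_memLp_top (h.memLp a)).const_mul _) (integrable_const 1),
    integral_const_mul, h.variance_one]
  simp
  linarith

end BoundedStandard

/-- The centred quadratic form `∑ A_kl (x_k conj(x_l) - δ_kl)` over the index set `s`. -/
noncomputable def centredForm [DecidableEq ι] (A : ι → ι → ℂ) (s : Finset ι) (x : ι → ℂ) : ℂ :=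
  ∑ k ∈ s, ∑ l ∈ s, A k l * (x k * star (x l) - if k = l then 1 else 0)

/-- The increment of the centred form when the index `a` is added: each of its three terms has mean
zero given the variables in `s`. -/
lemma centredForm_insert [DecidableEq ι] (A : ι → ι → ℂ) {s : Finset ι} {a : ι}
    (ha : a ∉ s) (x : ι → ℂ) :
    centredForm A (insert a s) x = centredForm A s x +
      (A a a * ((‖x a‖ ^ 2 - 1 : ℝ) : ℂ) + x a * star (∑ l ∈ s, star (A a l) * x l) +
        (∑ k ∈ s, A k a * x k) * star (x a)) := by
  have hne : ∀ l ∈ s, a ≠ l := fun l hl h => ha (h ▸ hl)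
  have e1 : ∑ l ∈ s, A a l * (x a * star (x l) - if a = l then 1 else 0) =
      x a * star (∑ l ∈ s, star (A a l) * x l) := by
    rw [star_sum, Finset.mul_sum]
    refine Finset.sum_congr rfl fun l hl => ?_
    rw [if_neg (hne l hl), star_mul, star_star]
    ring
  have e2 : ∑ k ∈ s, A k a * (x k * star (x a) - if k = a then 1 else 0) =
      (∑ k ∈ s, A k a * x k) * star (x a) := by
    rw [Finset.sum_mul]
    refine Finset.sum_congr rfl fun k hk => ?_
    rw [if_neg (hne k hk).symm]
    ring
  have e3 : x a * star (x a) = ((‖x a‖ ^ 2 : ℝ) : ℂ) := by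
    push_cast
    exact Complex.mul_conj' _
  unfold centredForm
  rw [Finset.sum_insert ha, Finset.sum_insert ha]
  simp_rw [Finset.sum_insert ha]
  rw [Finset.sum_add_distrib, e1, e2, e3]
  simp only [if_true]
  push_cast
  ring

lemma measurable_centredForm [DecidableEq ι] [Countable ι] (A : ι → ι → ℂ) (s : Finset ι) :
    Measurable (centredForm A s) := by
  unfold centredForm
  fun_prop

lemma linear_congr (b : ι → ℂ) {s : Finset ι} {x y : ι → ℂ} (hxy : ∀ i ∈ s, x i = y i) :
    ∑ l ∈ s, b l * x l = ∑ l ∈ s, b l * y l :=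
  Finset.sum_congr rfl fun l hl => by rw [hxy l hl]

lemma dependsOn_centredForm [DecidableEq ι] (A : ι → ι → ℂ) (s : Finset ι) :
    DependsOn (centredForm A s) (s : Set ι) := by
  intro x y hxy
  refine Finset.sum_congr rfl fun k hk => Finset.sum_congr rfl fun l hl => ?_
  rw [hxy k hk, hxy l hl]

lemma norm_add_three_sq_le (a b c : ℂ) : ‖a + b + c‖ ^ 2 ≤ 3 * (‖a‖ ^ 2 + ‖b‖ ^ 2 + ‖c‖ ^ 2) := by
  have h := norm_add₃_le (a := a) (b := b) (c := c)
  have h2 : ‖a + b + c‖ ^ 2 ≤ (‖a‖ + ‖b‖ + ‖c‖) ^ 2 := pow_le_pow_left₀ (norm_nonneg _) h 2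
  nlinarith [sq_nonneg (‖a‖ - ‖b‖), sq_nonneg (‖a‖ - ‖c‖), sq_nonneg (‖b‖ - ‖c‖)]

/-- Variance bound for quadratic forms. Adding one index at a time, the increments are martingale
differences, hence orthogonal. -/
lemma BoundedStandard.integral_norm_sq_centredForm_le [DecidableEq ι] [Countable ι]
    [IsProbabilityMeasure P] {ξ : ι → Ω → ℂ} {K : ℝ} (h : BoundedStandard ξ P K) (hK : 1 ≤ K)
    (A : ι → ι → ℂ) (s : Finset ι) :
    ∫ ω, ‖centredForm A s (fun i => ξ i ω)‖ ^ 2 ∂P ≤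
      3 * K ^ 2 * ∑ k ∈ s, ∑ l ∈ s, ‖A k l‖ ^ 2 := by
  induction s using Finset.induction_on with
  | empty => simp [centredForm]
  | insert a s ha ih =>
    simp_rw [centredForm_insert A ha]
    have hd : MemLp (fun ω => ((‖ξ a ω‖ ^ 2 - 1 : ℝ) : ℂ)) ⊤ P := by
      refine memLp_top_of_bound (C := K ^ 2 + 1) ?_ ?_
      · have := h.measurable a
        exact Measurable.aestronglyMeasurable (by fun_prop)
      · filter_upwards [h.bound a] with ω hω
        rw [Complex.norm_real, Real.norm_eq_abs, abs_le]
        have : ‖ξ a ω‖ ^ 2 ≤ K ^ 2 := pow_le_pow_left₀ (norm_nonneg _) hω 2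
        constructor <;> nlinarith [sq_nonneg ‖ξ a ω‖]
    have hQ : MemLp (fun ω => centredForm A s (fun i => ξ i ω)) ⊤ P := by
      unfold centredForm
      refine memLp_finsetSum _ fun k _ => memLp_finsetSum _ fun l _ => ?_
      exact ((memLp_top_mul (h.memLp k) (memLp_top_star (h.memLp l))).sub
        (memLp_const _)).const_mul _
    have hU := h.memLp_linear (fun l => star (A a l)) s
    have hV := h.memLp_linear (fun k => A k a) s
    have hR1 : MemLp (fun ω => A a a * ((‖ξ a ω‖ ^ 2 - 1 : ℝ) : ℂ)) ⊤ P := hd.const_mul _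
    have hR2 : MemLp (fun ω => ξ a ω * star (∑ l ∈ s, star (A a l) * ξ l ω)) ⊤ P :=
      memLp_top_mul (h.memLp a) (memLp_top_star hU)
    have hR3 : MemLp (fun ω => (∑ k ∈ s, A k a * ξ k ω) * star (ξ a ω)) ⊤ P :=
      memLp_top_mul hV (memLp_top_star (h.memLp a))
    have mQ := measurable_centredForm A s
    have hcov : ∀ (φ : (ι → ℂ) → ℂ) (ψ : ℂ → ℂ), Measurable φ → DependsOn φ (s : Set ι) →
        Measurable ψ → ∫ ω, ψ (ξ a ω) ∂P = 0 → ∫ ω, φ (fun i => ξ i ω) * ψ (ξ a ω) ∂P = 0 := by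
      intro φ ψ hφ hφs hψ h0
      rw [integral_dependsOn_mul h.indep h.measurable ha hφ hφs hψ, h0, mul_zero]
    have hR123 : MemLp (fun ω => A a a * ((‖ξ a ω‖ ^ 2 - 1 : ℝ) : ℂ) +
        ξ a ω * star (∑ l ∈ s, star (A a l) * ξ l ω) +
        (∑ k ∈ s, A k a * ξ k ω) * star (ξ a ω)) ⊤ P := (hR1.add hR2).add hR3
    rw [integral_norm_sq_add_of_orthogonal hQ hR123]
    · have hvar : ∀ b : ι → ℂ, ∫ ω, ‖∑ l ∈ s, b l * ξ l ω‖ ^ 2 * ‖ξ a ω‖ ^ 2 ∂P =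
          ∑ l ∈ s, ‖b l‖ ^ 2 := by
        intro b
        have := integral_dependsOn_mul h.indep h.measurable ha
          (φ := fun x => ‖∑ l ∈ s, b l * x l‖ ^ 2) (ψ := fun x => ‖x‖ ^ 2) (by fun_prop)
          (fun x y hxy => by simp only; rw [linear_congr b hxy]) (by fun_prop)
        rw [this, h.integral_norm_sq_linear, h.variance_one, mul_one]
      have hR : ∫ ω, ‖A a a * ((‖ξ a ω‖ ^ 2 - 1 : ℝ) : ℂ) +
          ξ a ω * star (∑ l ∈ s, star (A a l) * ξ l ω) +
          (∑ k ∈ s, A k a * ξ k ω) * star (ξ a ω)‖ ^ 2 ∂P ≤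
          3 * (‖A a a‖ ^ 2 * K ^ 2 + ∑ l ∈ s, ‖A a l‖ ^ 2 + ∑ k ∈ s, ‖A k a‖ ^ 2) := by
        have i1 := integrable_norm_sq_of_memLp_top hR1
        have i2 := integrable_norm_sq_of_memLp_top hR2
        have i3 := integrable_norm_sq_of_memLp_top hR3
        refine (integral_mono (integrable_norm_sq_of_memLp_top hR123)
          (((i1.add i2).add i3).const_mul 3) fun ω => norm_add_three_sq_le _ _ _).trans ?_
        rw [integral_const_mul, integral_add' (i1.add i2) i3, integral_add' i1 i2]
        have j1 : ∫ ω, ‖A a a * ((‖ξ a ω‖ ^ 2 - 1 : ℝ) : ℂ)‖ ^ 2 ∂P ≤ ‖A a a‖ ^ 2 * K ^ 2 := by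
          simp_rw [norm_mul, mul_pow]
          rw [integral_const_mul]
          exact mul_le_mul_of_nonneg_left (h.integral_sq_norm_sq_sub_one_le a) (by positivity)
        have j2 : ∫ ω, ‖ξ a ω * star (∑ l ∈ s, star (A a l) * ξ l ω)‖ ^ 2 ∂P =
            ∑ l ∈ s, ‖A a l‖ ^ 2 := by
          have := hvar fun l => star (A a l)
          simp_rw [norm_star] at this
          rw [← this]
          simp_rw [norm_mul, norm_star, mul_pow, mul_comm]
        have j3 : ∫ ω, ‖(∑ k ∈ s, A k a * ξ k ω) * star (ξ a ω)‖ ^ 2 ∂P =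
            ∑ k ∈ s, ‖A k a‖ ^ 2 := by
          rw [← hvar fun k => A k a]
          simp_rw [norm_mul, norm_star, mul_pow]
        rw [j2, j3]
        linarith
      have hexp : ∑ k ∈ insert a s, ∑ l ∈ insert a s, ‖A k l‖ ^ 2 = ‖A a a‖ ^ 2 +
          ∑ l ∈ s, ‖A a l‖ ^ 2 + ∑ k ∈ s, ‖A k a‖ ^ 2 + ∑ k ∈ s, ∑ l ∈ s, ‖A k l‖ ^ 2 := by
        rw [Finset.sum_insert ha, Finset.sum_insert ha]
        simp_rw [Finset.sum_insert ha]
        rw [Finset.sum_add_distrib]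
        ring
      rw [hexp]
      have p1 : 0 ≤ ∑ l ∈ s, ‖A a l‖ ^ 2 := by positivity
      have p2 : 0 ≤ ∑ k ∈ s, ‖A k a‖ ^ 2 := by positivity
      have hK2 : 1 ≤ K ^ 2 := one_le_pow₀ hK
      nlinarith [mul_le_mul_of_nonneg_right hK2 p1, mul_le_mul_of_nonneg_right hK2 p2]
    · have e : ∀ ω, centredForm A s (fun i => ξ i ω) *
          star (A a a * ((‖ξ a ω‖ ^ 2 - 1 : ℝ) : ℂ) +
          ξ a ω * star (∑ l ∈ s, star (A a l) * ξ l ω) +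
          (∑ k ∈ s, A k a * ξ k ω) * star (ξ a ω)) =
          (centredForm A s (fun i => ξ i ω) * star (A a a)) * ((‖ξ a ω‖ ^ 2 - 1 : ℝ) : ℂ) +
          (centredForm A s (fun i => ξ i ω) * (∑ l ∈ s, star (A a l) * ξ l ω)) * star (ξ a ω) +
          (centredForm A s (fun i => ξ i ω) * star (∑ k ∈ s, A k a * ξ k ω)) * ξ a ω := by
        intro ω
        simp only [star_add, star_mul, star_star]
        have : star ((‖ξ a ω‖ ^ 2 - 1 : ℝ) : ℂ) = ((‖ξ a ω‖ ^ 2 - 1 : ℝ) : ℂ) :=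
          Complex.conj_ofReal _
        rw [this]
        ring
      have k1 : ∫ ω, (centredForm A s (fun i => ξ i ω) * star (A a a)) *
          ((‖ξ a ω‖ ^ 2 - 1 : ℝ) : ℂ) ∂P = 0 := by
        refine hcov (fun x => centredForm A s x * star (A a a))
          (fun x => ((‖x‖ ^ 2 - 1 : ℝ) : ℂ)) (by fun_prop)
          (fun x y hxy => by simp only; rw [dependsOn_centredForm A s hxy]) (by fun_prop) ?_
        rw [integral_complex_ofReal, integral_sub (integrable_norm_sq_of_memLp_top (h.memLp a))
          (integrable_const 1), h.variance_one]
        simp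
      have k2 : ∫ ω, (centredForm A s (fun i => ξ i ω) * (∑ l ∈ s, star (A a l) * ξ l ω)) *
          star (ξ a ω) ∂P = 0 :=
        hcov (fun x => centredForm A s x * (∑ l ∈ s, star (A a l) * x l)) star (by fun_prop)
          (fun x y hxy => by
            simp only
            rw [dependsOn_centredForm A s hxy, linear_congr (fun l => star (A a l)) hxy])
          (by fun_prop) (h.integral_star a)
      have k3 : ∫ ω, (centredForm A s (fun i => ξ i ω) * star (∑ k ∈ s, A k a * ξ k ω)) *
          ξ a ω ∂P = 0 :=
        hcov (fun x => centredForm A s x * star (∑ k ∈ s, A k a * x k)) id (by fun_prop)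
          (fun x y hxy => by
            simp only
            rw [dependsOn_centredForm A s hxy, linear_congr (fun k => A k a) hxy])
          (by fun_prop) (h.mean_zero a)
      simp_rw [e]
      have m1 := integrable_of_memLp_top (memLp_top_mul (hQ.mul_const (star (A a a))) hd)
      have m2 := integrable_of_memLp_top (memLp_top_mul (memLp_top_mul hQ hU)
        (memLp_top_star (h.memLp a)))
      have m3 := integrable_of_memLp_top (memLp_top_mul (memLp_top_mul hQ (memLp_top_star hV))
        (h.memLp a))
      rw [integral_add (by exact m1.add m2) m3, integral_add m1 m2, k1, k2, k3]
      simp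

end QuadraticForm
/-! ### The self-consistent equation in mean -/

section SelfConsistent

variable {p n : ℕ} {Ω : Type*} [MeasurableSpace Ω] {P : Measure Ω}

lemma rowForm_sub_stieltjes (z : ℂ) (X : Fin p → Fin n → ℂ) (i : Fin p) :
    rowForm z X i - stieltjes z (Function.update X i 0) = (n : ℂ)⁻¹ *
      centredForm (resolventMatrix z (covMatrix (Matrix.of (Function.update X i 0))))
        Finset.univ (X i) := by
  rw [rowForm, stieltjes]
  push_cast
  rw [← mul_sub]
  congr 1
  simp only [centredForm, mul_sub, Finset.sum_sub_distrib, star_star, dotProduct, Matrix.mulVec,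
    Finset.mul_sum, Matrix.trace, Matrix.diag, Pi.star_apply]
  congr 1
  · exact Finset.sum_congr rfl fun k _ => Finset.sum_congr rfl fun l _ => by ring
  · simp

/-- The deviation of the quadratic form `q_i` from the normalized trace has variance of order
`K² / n`: the row `i` is independent of the resolvent from which it has been removed. -/
lemma lintegral_rowForm_sub_stieltjes_le [IsProbabilityMeasure P] {X : Ω → Fin p → Fin n → ℂ}
    {K : ℝ} (hX : BoundedStandard (fun (ij : Fin p × Fin n) ω => X ω ij.1 ij.2) P K) (hK : 1 ≤ K)
    (t : ℝ) {η : ℝ} (hη : 0 < η) (i : Fin p) :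
    ∫⁻ ω, ENNReal.ofReal (‖rowForm (t + η * Complex.I) (X ω) i -
      stieltjes (t + η * Complex.I) (Function.update (X ω) i 0)‖ ^ 2) ∂P ≤
      ENNReal.ofReal (3 * K ^ 2 / (n * η ^ 2)) := by
  set z : ℂ := t + η * Complex.I with hz
  have hzim : z.im = η := by simp [hz]
  have hXm : Measurable X :=
    measurable_pi_lambda _ fun a => measurable_pi_lambda _ fun b => hX.measurable (a, b)
  set F : (Fin n → ℂ) × (Fin p → Fin n → ℂ) → ℝ≥0∞ := fun q => ENNReal.ofReal
    (‖(n : ℂ)⁻¹ * centredForm (resolventMatrix z (covMatrix (Matrix.of q.2)))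
        Finset.univ q.1‖ ^ 2) with hF
  have hFm : Measurable F := by
    have hc : Continuous fun q : (Fin n → ℂ) × (Fin p → Fin n → ℂ) =>
        resolventMatrix z (covMatrix (Matrix.of q.2)) := by
      have h : Continuous fun q : (Fin n → ℂ) × (Fin p → Fin n → ℂ) => (t, q.2) := by fun_prop
      simpa only [Function.comp_def] using (continuous_resolventMatrix_covMatrix hη).comp h
    have hc' : Continuous fun q : (Fin n → ℂ) × (Fin p → Fin n → ℂ) => (n : ℂ)⁻¹ *
        centredForm (resolventMatrix z (covMatrix (Matrix.of q.2))) Finset.univ q.1 := by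
      unfold centredForm
      refine continuous_const.mul (continuous_finsetSum _ fun k _ =>
        continuous_finsetSum _ fun l _ => (hc.matrix_elem k l).mul ?_)
      fun_prop
    exact (ENNReal.continuous_ofReal.comp (hc'.norm.pow 2)).measurable
  set r : Ω → Fin n → ℂ := fun ω => X ω i with hr
  set U : Ω → Fin p → Fin n → ℂ := fun ω => Function.update (X ω) i 0 with hU
  have hrm : Measurable r := (measurable_pi_apply i).comp hXm
  have hUm : Measurable U := by
    refine measurable_pi_lambda _ fun a => ?_
    by_cases h : a = i
    · subst h; simp [hU]
    · have : (fun ω => U ω a) = fun ω => X ω a := by simp [hU, h]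
      rw [this]
      exact (measurable_pi_apply a).comp hXm
  have hrU : IndepFun r U P := by
    have hd : Disjoint (Finset.univ.filter fun ij : Fin p × Fin n => ij.1 = i)
        (Finset.univ.filter fun ij : Fin p × Fin n => ij.1 ≠ i) :=
      Finset.disjoint_filter_filter_not _ _ _
    have h0 := indepFun_zero_extend hX.indep hX.measurable hd
    have h1 := h0.comp (φ := fun x j => x (i, j)) (ψ := fun x a b => x (a, b))
      (by fun_prop) (by fun_prop)
    convert h1 using 1
    · funext ω j
      simp [hr]
    · funext ω a b
      by_cases h : a = i
      · subst h; simp [hU]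
      · simp [hU, h]
  have hmap : P.map (fun ω => (r ω, U ω)) = (P.map r).prod (P.map U) :=
    (indepFun_iff_map_prod_eq_prod_map_map hrm.aemeasurable hUm.aemeasurable).mp hrU
  have hprob1 : IsProbabilityMeasure (P.map r) := Measure.isProbabilityMeasure_map hrm.aemeasurable
  have hprob2 : IsProbabilityMeasure (P.map U) := Measure.isProbabilityMeasure_map hUm.aemeasurable
  have hrow : BoundedStandard (fun j ω => r ω j) P K :=
    { indep := hX.indep.precomp (g := fun j => (i, j)) (fun a b h => by simpa using h)
      measurable := fun j => hX.measurable (i, j)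
      mean_zero := fun j => hX.mean_zero (i, j)
      variance_one := fun j => hX.variance_one (i, j)
      bound := fun j => hX.bound (i, j) }
  have hinner : ∀ Y : Fin p → Fin n → ℂ, ∫⁻ x, F (x, Y) ∂(P.map r) ≤
      ENNReal.ofReal (3 * K ^ 2 / (n * η ^ 2)) := by
    intro Y
    set R := resolventMatrix z (covMatrix (Matrix.of Y)) with hR
    rw [lintegral_map (f := fun x => F (x, Y)) (hFm.comp measurable_prodMk_right) hrm]
    have hmem : MemLp (fun ω => centredForm R Finset.univ (r ω)) ⊤ P := by
      unfold centredForm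
      refine memLp_finsetSum _ fun k _ => memLp_finsetSum _ fun l _ => ?_
      exact ((memLp_top_mul (hrow.memLp k) (memLp_top_star (hrow.memLp l))).sub
        (memLp_const _)).const_mul _
    have hint := integrable_norm_sq_of_memLp_top (hmem.const_mul ((n : ℂ)⁻¹))
    simp only [hF]
    rw [← ofReal_integral_eq_lintegral_ofReal hint (ae_of_all _ fun ω => by positivity)]
    refine ENNReal.ofReal_le_ofReal ?_
    simp_rw [norm_mul, mul_pow]
    rw [integral_const_mul]
    have h1 := hrow.integral_norm_sq_centredForm_le hK R Finset.univ
    have h2 := sum_norm_sq_resolventMatrix_le (covMatrix_isHermitian (Matrix.of Y))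
      (z := z) (by rw [hzim]; exact hη)
    rw [hzim, Fintype.card_fin] at h2
    rw [norm_inv, Complex.norm_natCast]
    have h3 : ∫ ω, ‖centredForm R Finset.univ (r ω)‖ ^ 2 ∂P ≤
        3 * K ^ 2 * (n * (η⁻¹) ^ 2) := h1.trans (mul_le_mul_of_nonneg_left h2 (by positivity))
    refine (mul_le_mul_of_nonneg_left h3 (by positivity)).trans (le_of_eq ?_)
    rcases Nat.eq_zero_or_pos n with rfl | hn
    · simp
    have : (n : ℝ) ≠ 0 := by exact_mod_cast hn.ne'
    field_simp
  have hFeq : ∀ ω, ENNReal.ofReal (‖rowForm z (X ω) i - stieltjes z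
      (Function.update (X ω) i 0)‖ ^ 2) = F (r ω, U ω) := by
    intro ω
    rw [rowForm_sub_stieltjes]
  simp_rw [hFeq]
  rw [← lintegral_map hFm (hrm.prodMk hUm), hmap, lintegral_prod_symm' _ hFm]
  refine (lintegral_mono fun Y => hinner Y).trans ?_
  simp

lemma continuous_rowForm_sub (t : ℝ) {η : ℝ} (hη : 0 < η) (i : Fin p) :
    Continuous fun X : Fin p → Fin n → ℂ => rowForm (t + η * Complex.I) X i -
      stieltjes (t + η * Complex.I) (Function.update X i 0) := by
  have hupd : Continuous fun X : Fin p → Fin n → ℂ => Function.update X i 0 :=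
    continuous_id.update i continuous_const
  have hc : Continuous fun X : Fin p → Fin n → ℂ =>
      resolventMatrix (t + η * Complex.I) (covMatrix (Matrix.of (Function.update X i 0))) := by
    have h : Continuous fun X : Fin p → Fin n → ℂ => (t, Function.update X i 0) := by fun_prop
    simpa only [Function.comp_def] using (continuous_resolventMatrix_covMatrix hη).comp h
  simp_rw [rowForm_sub_stieltjes]
  unfold centredForm
  refine continuous_const.mul (continuous_finsetSum _ fun k _ =>
    continuous_finsetSum _ fun l _ => (hc.matrix_elem k l).mul ?_)
  fun_prop

lemma integral_norm_rowForm_sub_stieltjes_le [IsProbabilityMeasure P] {X : Ω → Fin p → Fin n → ℂ}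
    {K : ℝ} (hX : BoundedStandard (fun (ij : Fin p × Fin n) ω => X ω ij.1 ij.2) P K) (hK : 1 ≤ K)
    (t : ℝ) {η : ℝ} (hη : 0 < η) (i : Fin p) :
    Integrable (fun ω => ‖rowForm (t + η * Complex.I) (X ω) i -
      stieltjes (t + η * Complex.I) (Function.update (X ω) i 0)‖) P ∧
    ∫ ω, ‖rowForm (t + η * Complex.I) (X ω) i -
      stieltjes (t + η * Complex.I) (Function.update (X ω) i 0)‖ ∂P ≤
      √(3 * K ^ 2 / (n * η ^ 2)) := by
  set z : ℂ := t + η * Complex.I with hz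
  have hXm : Measurable X :=
    measurable_pi_lambda _ fun a => measurable_pi_lambda _ fun b => hX.measurable (a, b)
  set g : Ω → ℂ := fun ω => rowForm z (X ω) i - stieltjes z (Function.update (X ω) i 0) with hg
  have hgm : Measurable g := (continuous_rowForm_sub t hη i).measurable.comp hXm
  have hl := lintegral_rowForm_sub_stieltjes_le hX hK t hη i
  set V := 3 * K ^ 2 / (n * η ^ 2) with hV
  have hV0 : 0 ≤ V := by positivity
  have hint2 : Integrable (fun ω => ‖g ω‖ ^ 2) P := by
    refine ⟨(hgm.norm.pow_const 2).aestronglyMeasurable, ?_⟩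
    rw [hasFiniteIntegral_iff_ofReal (ae_of_all _ fun ω => by positivity)]
    exact hl.trans_lt ENNReal.ofReal_lt_top
  have hI2 : ∫ ω, ‖g ω‖ ^ 2 ∂P ≤ V := by
    rw [integral_eq_lintegral_of_nonneg_ae (ae_of_all _ fun ω => by positivity)
      (hgm.norm.pow_const 2).aestronglyMeasurable]
    exact ENNReal.toReal_le_of_le_ofReal hV0 hl
  have hmem : MemLp (fun ω => ‖g ω‖) 2 P := by
    rw [memLp_two_iff_integrable_sq hgm.norm.aestronglyMeasurable]
    exact hint2
  refine ⟨hmem.integrable (by norm_num), Real.le_sqrt_of_sq_le ?_⟩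
  have hvar := variance_nonneg (fun ω => ‖g ω‖) P
  rw [variance_eq_sub hmem] at hvar
  have : ∫ ω, ((fun ω => ‖g ω‖) ^ 2) ω ∂P ≤ V := hI2
  linarith

/-- The Stieltjes transform satisfies the limiting quadratic equation up to an error which is small
in expectation as soon as `K² / n` is small. -/
lemma integral_norm_quadratic_le [IsProbabilityMeasure P] {X : Ω → Fin p → Fin n → ℂ}
    {K : ℝ} (hX : BoundedStandard (fun (ij : Fin p × Fin n) ω => X ω ij.1 ij.2) P K) (hK : 1 ≤ K)
    (hn : 0 < n) (hpn : p ≤ n) (t : ℝ) {η : ℝ} (hη : 0 < η) {z : ℂ} (hz : z = t + η * Complex.I) :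
    ∫ ω, ‖z * stieltjes z (X ω) ^ 2 + (z + 1 - (p / n : ℝ)) * stieltjes z (X ω) + 1‖ ∂P ≤
      ‖z‖ / η * (√(3 * K ^ 2 / (n * η ^ 2)) + (n * η)⁻¹) := by
  have hzim : z.im = η := by simp [hz]
  have hb := fun ω => norm_stieltjes_quadratic_le (z := z) (by rw [hzim]; exact hη) hn (X ω)
  rw [hzim] at hb
  have hi := fun i => integral_norm_rowForm_sub_stieltjes_le hX hK t hη i
  rw [← hz] at hi
  have hint : ∀ i, Integrable (fun ω => (‖z‖ / η) * (‖rowForm z (X ω) i -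
      stieltjes z (Function.update (X ω) i 0)‖ + (n * η)⁻¹)) P := fun i =>
    ((hi i).1.add (integrable_const _)).const_mul _
  have hn' : (0 : ℝ) < n := by exact_mod_cast hn
  refine (integral_mono_of_nonneg (ae_of_all _ fun ω => norm_nonneg _)
    ((integrable_finsetSum _ fun i _ => hint i).const_mul _) (ae_of_all _ hb)).trans ?_
  rw [integral_const_mul, integral_finsetSum _ fun i _ => hint i]
  have : ∀ i ∈ Finset.univ, ∫ ω, (‖z‖ / η) * (‖rowForm z (X ω) i -
      stieltjes z (Function.update (X ω) i 0)‖ + (n * η)⁻¹) ∂P ≤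
      ‖z‖ / η * (√(3 * K ^ 2 / (n * η ^ 2)) + (n * η)⁻¹) := by
    intro i _
    rw [integral_const_mul, integral_add (hi i).1 (integrable_const _)]
    refine mul_le_mul_of_nonneg_left ?_ (by positivity)
    simpa using (hi i).2
  have h2 := Finset.sum_le_sum this
  rw [Finset.sum_const, Finset.card_univ, Fintype.card_fin, nsmul_eq_mul] at h2
  refine (mul_le_mul_of_nonneg_left h2 (by positivity)).trans ?_
  rw [← mul_assoc]
  refine mul_le_of_le_one_left (by positivity) ?_
  rw [inv_mul_le_iff₀ hn', mul_one]
  exact_mod_cast hpn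

end SelfConsistent
/-! ### Bounded differences and independence of rows -/

section BoundedDifferences

/-- **McDiarmid's inequality**, as a bound on the moment generating function: on a product space,
a bounded function which changes by at most `c` when one coordinate is changed is sub-Gaussian around
its mean, with a parameter proportional to the number of coordinates. -/
lemma hasSubgaussianMGF_of_bounded_differences {E : Type*} [MeasurableSpace E] {m : ℕ}
    (μ : Fin m → Measure E) [∀ i, IsProbabilityMeasure (μ i)] {f : (Fin m → E) → ℝ}
    (hf : Measurable f) {b : ℝ} (hb : ∀ x, |f x| ≤ b) {c : ℝ} (hc : 0 ≤ c)
    (hd : ∀ x i y, |f x - f (Function.update x i y)| ≤ c) :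
    HasSubgaussianMGF (fun x => f x - ∫ x, f x ∂(Measure.pi μ)) (m * (c ^ 2).toNNReal)
      (Measure.pi μ) := by
  induction m with
  | zero =>
    have h0 : (fun x : Fin 0 → E => f x - ∫ x, f x ∂(Measure.pi μ)) = fun _ => 0 := by
      funext x
      have : ∀ y, f y = f x := fun y => by rw [Subsingleton.elim y x]
      simp [this]
    rw [h0]
    simp
  | succ m ih =>
    set π : Measure (Fin m → E) := Measure.pi fun j => μ j.succ with hπ
    have hmp : MeasurePreserving (fun q : E × (Fin m → E) => (Fin.cons q.1 q.2 : Fin (m + 1) → E))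
        ((μ 0).prod π) (Measure.pi μ) := by
      have := (measurePreserving_piFinSuccAbove μ 0).symm
      simpa [MeasurableEquiv.piFinSuccAbove_symm_apply, Fin.insertNthEquiv] using this
    set F : E × (Fin m → E) → ℝ := fun q => f (Fin.cons q.1 q.2) with hF
    have hFm : Measurable F := hf.comp hmp.measurable
    set M := ∫ x, f x ∂(Measure.pi μ) with hM
    have hFb : ∀ q, |F q| ≤ b := fun q => hb _
    have hFint : Integrable F ((μ 0).prod π) :=
      Integrable.of_bound hFm.aestronglyMeasurable b (ae_of_all _ hFb)
    set g : E → ℝ := fun x => ∫ r, F (x, r) ∂π with hg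
    have hgm : Measurable g := hFm.stronglyMeasurable.integral_prod_right'.measurable
    have hMg : M = ∫ x, g x ∂(μ 0) := by
      rw [hM, ← hmp.map_eq, integral_map hmp.measurable.aemeasurable hf.aestronglyMeasurable]
      exact integral_prod _ hFint
    have hFxint : ∀ x, Integrable (fun r => F (x, r)) π := fun x =>
      Integrable.of_bound (hFm.comp measurable_prodMk_left).aestronglyMeasurable b
        (ae_of_all _ fun r => hFb _)
    have hFd : ∀ x x' r, |F (x, r) - F (x', r)| ≤ c := by
      intro x x' r
      have := hd (Fin.cons x r) 0 x'
      rwa [Fin.update_cons_zero] at this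
    have hgd : ∀ x x', |g x - g x'| ≤ c := by
      intro x x'
      rw [hg]
      simp only
      rw [← integral_sub (hFxint x) (hFxint x')]
      have := norm_integral_le_of_norm_le_const (μ := π) (C := c)
        (f := fun r => F (x, r) - F (x', r)) (ae_of_all _ fun r => hFd x x' r)
      simpa using this
    -- the average over all coordinates but one oscillates by at most `c`: Hoeffding's lemma
    obtain ⟨x₀⟩ : Nonempty E := nonempty_of_isProbabilityMeasure (μ 0)
    have hgsub : HasSubgaussianMGF (fun x => g x - M) (c ^ 2).toNNReal (μ 0) := by
      have := hasSubgaussianMGF_of_mem_Icc (μ := μ 0) (X := g) (a := g x₀ - c) (b := g x₀ + c)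
        hgm.aemeasurable (ae_of_all _ fun x => by
          have := abs_le.mp (hgd x x₀)
          constructor <;> linarith [this.1, this.2])
      rw [← hMg] at this
      convert this using 1
      ext
      rw [Real.coe_toNNReal _ (by positivity)]
      push_cast
      rw [show g x₀ + c - (g x₀ - c) = 2 * c by ring, Real.norm_of_nonneg (by positivity)]
      ring
    have hxsub : ∀ x, HasSubgaussianMGF (fun r => F (x, r) - g x) (m * (c ^ 2).toNNReal) π := by
      intro x
      refine ih (fun j => μ j.succ) (f := fun r => F (x, r)) (hFm.comp measurable_prodMk_left)
        (fun r => hFb _) fun r i y => ?_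
      have := hd (Fin.cons x r) i.succ y
      rwa [← Fin.cons_update] at this
    have hint : ∀ t, Integrable (fun q => Real.exp (t * (F q - M))) ((μ 0).prod π) := fun t =>
      integrable_exp_mul_of_mem_Icc (a := -b - M) (b := b - M) (by fun_prop)
        (ae_of_all _ fun q => by
          have := abs_le.mp (hFb q)
          constructor <;> linarith [this.1, this.2])
    have hprod : HasSubgaussianMGF (fun q => F q - M) ((m + 1 : ℕ) * (c ^ 2).toNNReal)
        ((μ 0).prod π) := by
      refine ⟨hint, fun t => ?_⟩
      rw [mgf, integral_prod _ (hint t)]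
      have h1 : ∀ x, ∫ r, Real.exp (t * (F (x, r) - M)) ∂π ≤ Real.exp (t * (g x - M)) *
          Real.exp ((m * (c ^ 2).toNNReal : ℝ≥0) * t ^ 2 / 2) := by
        intro x
        have h2 : ∀ r, Real.exp (t * (F (x, r) - M)) =
            Real.exp (t * (g x - M)) * Real.exp (t * (F (x, r) - g x)) := by
          intro r
          rw [← Real.exp_add]
          ring_nf
        simp_rw [h2]
        rw [integral_const_mul]
        exact mul_le_mul_of_nonneg_left ((hxsub x).mgf_le t) (Real.exp_pos _).le
      refine (integral_mono (hint t).integral_prod_left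
        ((hgsub.integrable_exp_mul t).mul_const _) h1).trans ?_
      rw [integral_mul_const]
      refine (mul_le_mul_of_nonneg_right (hgsub.mgf_le t) (Real.exp_pos _).le).trans
        (le_of_eq ?_)
      rw [← Real.exp_add]
      push_cast
      ring_nf
    have hid : HasSubgaussianMGF (fun x => f x - M) ((m + 1 : ℕ) * (c ^ 2).toNNReal)
        (((μ 0).prod π).map fun q => (Fin.cons q.1 q.2 : Fin (m + 1) → E)) := by
      refine ⟨fun t => ?_, fun t => ?_⟩
      · rw [integrable_map_measure (by fun_prop) hmp.measurable.aemeasurable]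
        exact hint t
      · rw [mgf_map hmp.measurable.aemeasurable (by fun_prop)]
        exact hprod.mgf_le t
    rwa [hmp.map_eq] at hid

/-- Two-sided tail bound for a function of independent random variables with bounded
differences. -/
lemma measure_abs_sub_integral_ge_le {Ω E : Type*} [MeasurableSpace Ω] {P : Measure Ω}
    [IsProbabilityMeasure P] [MeasurableSpace E] {m : ℕ} {X : Ω → Fin m → E}
    (hX : ∀ i, Measurable fun ω => X ω i) (hind : iIndepFun (fun i ω => X ω i) P)
    {f : (Fin m → E) → ℝ} (hf : Measurable f) {b : ℝ} (hb : ∀ x, |f x| ≤ b) {c : ℝ} (hc : 0 ≤ c)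
    (hd : ∀ x i y, |f x - f (Function.update x i y)| ≤ c) {s : ℝ} (hs : 0 ≤ s) :
    P.real {ω | s ≤ |f (X ω) - ∫ ω, f (X ω) ∂P|} ≤
      2 * Real.exp (-s ^ 2 / (2 * (m * c ^ 2))) := by
  have hXm : Measurable X := measurable_pi_lambda _ hX
  have hprob : ∀ i, IsProbabilityMeasure (P.map fun ω => X ω i) := fun i =>
    Measure.isProbabilityMeasure_map (hX i).aemeasurable
  have hmap : P.map X = Measure.pi fun i => P.map fun ω => X ω i :=
    hind.map_fun_eq_pi_map fun i => (hX i).aemeasurable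
  have hsub := hasSubgaussianMGF_of_bounded_differences (fun i => P.map fun ω => X ω i) hf hb hc hd
  rw [← hmap, integral_map hXm.aemeasurable hf.aestronglyMeasurable] at hsub
  have hsub' := HasSubgaussianMGF.of_map hXm.aemeasurable hsub
  have h1 := hsub'.measure_ge_le hs
  have h2 := hsub'.neg.measure_ge_le hs
  have hco : (((m : ℝ≥0) * (c ^ 2).toNNReal : ℝ≥0) : ℝ) = m * c ^ 2 := by
    push_cast
    rw [Real.coe_toNNReal _ (by positivity)]
  rw [hco] at h1 h2
  have hsubset : {ω | s ≤ |f (X ω) - ∫ ω, f (X ω) ∂P|} ⊆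
      {ω | s ≤ ((fun x => f x - ∫ ω, f (X ω) ∂P) ∘ X) ω} ∪
      {ω | s ≤ (-((fun x => f x - ∫ ω, f (X ω) ∂P) ∘ X)) ω} := by
    intro ω hω
    simp only [Set.mem_ofPred_eq] at hω
    rcases le_abs.mp hω with h | h
    · exact Or.inl h
    · exact Or.inr h
  refine (measureReal_mono hsubset).trans ((measureReal_union_le _ _).trans ?_)
  linarith

/-- The rows of a matrix with independent entries are independent. -/
lemma iIndepFun_rows {Ω ι κ E : Type*} [Fintype ι] [Fintype κ] [MeasurableSpace Ω] {P : Measure Ω}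
    [MeasurableSpace E] {X : Ω → ι → κ → E}
    (hm : ∀ i j, Measurable fun ω => X ω i j)
    (hind : iIndepFun (fun (ij : ι × κ) ω => X ω ij.1 ij.2) P) :
    iIndepFun (fun i ω => X ω i) P := by
  have := hind.isProbabilityMeasure
  have hp : ∀ i j, IsProbabilityMeasure (P.map fun ω => X ω i j) := fun i j =>
    Measure.isProbabilityMeasure_map (hm i j).aemeasurable
  have hrm : ∀ i, Measurable fun ω => X ω i := fun i => measurable_pi_lambda _ (hm i)
  have hrow : ∀ i, P.map (fun ω => X ω i) =
      Measure.infinitePi fun j => P.map fun ω => X ω i j := fun i =>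
    (iIndepFun_iff_map_fun_eq_infinitePi_map (X := fun j ω => X ω i j) (hm i)).1
      (hind.precomp (g := fun j => (i, j)) fun a b h => by simpa using h)
  have hsig : iIndepFun (fun (q : (_ : ι) × κ) ω => X ω q.1 q.2) P :=
    hind.precomp (g := Equiv.sigmaEquivProd ι κ) (Equiv.injective _)
  have hall := (iIndepFun_iff_map_fun_eq_infinitePi_map
    (X := fun (q : (_ : ι) × κ) ω => X ω q.1 q.2) fun q => hm q.1 q.2).1 hsig
  rw [iIndepFun_iff_map_fun_eq_infinitePi_map hrm]
  simp_rw [hrow]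
  rw [← Measure.infinitePi_map_piCurry (fun i j => P.map fun ω => X ω i j), ← hall]
  have hX : Measurable fun ω (q : (_ : ι) × κ) => X ω q.1 q.2 :=
    measurable_pi_lambda _ fun q => hm q.1 q.2
  exact (Measure.map_map (MeasurableEquiv.piCurry fun (_ : ι) (_ : κ) => E).measurable hX).symm

end BoundedDifferences
/-! ### The limiting quadratic equation and its stability -/

section Stability

lemma edge_identity {y : ℝ} (hy : 0 ≤ y) (t : ℝ) :
    (edgeRight y - t) * (t - edgeLeft y) = 4 * t - (t + 1 - y) ^ 2 := by
  have h := Real.sq_sqrt hy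
  unfold edgeRight edgeLeft
  linear_combination (2 * t + 2 - (√y ^ 2 + y)) * h

/-- The boundary value at `t` of the limiting Stieltjes transform: the root in the upper half plane
of `t h² + (t + 1 - y) h + 1 = 0`. -/
noncomputable def limitStieltjes (y t : ℝ) : ℂ :=
  ⟨-(t + 1 - y) / (2 * t), √((edgeRight y - t) * (t - edgeLeft y)) / (2 * t)⟩

lemma edgeLeft_nonneg (y : ℝ) : 0 ≤ edgeLeft y := sq_nonneg _

lemma edgeRight_le_four {y : ℝ} (hy1 : y ≤ 1) : edgeRight y ≤ 4 := by
  have : √y ≤ 1 := Real.sqrt_le_one.mpr hy1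
  unfold edgeRight
  nlinarith [Real.sqrt_nonneg y]

lemma limitStieltjes_im {y : ℝ} (hy : 0 < y) {t : ℝ}
    (ht : t ∈ Set.Icc (edgeLeft y) (edgeRight y)) :
    (limitStieltjes y t).im = Real.pi * y * marchenkoPastur y t := by
  rw [marchenkoPastur, Set.indicator_of_mem ht, limitStieltjes]
  have := Real.pi_pos
  simp only
  field_simp

lemma le_mul_edge {y ε t : ℝ} (hε : 0 < ε)
    (ht : t ∈ Set.Icc (edgeLeft y + ε) (edgeRight y - ε)) :
    ε ^ 2 ≤ (edgeRight y - t) * (t - edgeLeft y) := by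
  rw [sq]
  exact mul_le_mul (by linarith [ht.2]) (by linarith [ht.1]) hε.le (by linarith [ht.2])

lemma le_limitStieltjes_im {y ε t : ℝ} (hy1 : y ≤ 1) (hε : 0 < ε)
    (ht : t ∈ Set.Icc (edgeLeft y + ε) (edgeRight y - ε)) :
    ε / 8 ≤ (limitStieltjes y t).im := by
  have ht0 : ε ≤ t := by linarith [ht.1, edgeLeft_nonneg y]
  have ht4 : t ≤ 4 := by linarith [ht.2, edgeRight_le_four hy1]
  have h1 : ε ≤ √((edgeRight y - t) * (t - edgeLeft y)) := Real.le_sqrt_of_sq_le (le_mul_edge hε ht)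
  simp only [limitStieltjes]
  rw [div_le_div_iff₀ (by norm_num) (by linarith)]
  nlinarith

lemma mul_normSq_limitStieltjes {y ε t : ℝ} (hy : 0 < y) (hε : 0 < ε)
    (ht : t ∈ Set.Icc (edgeLeft y + ε) (edgeRight y - ε)) :
    t * Complex.normSq (limitStieltjes y t) = 1 := by
  have ht0 : 0 < t := by linarith [ht.1, edgeLeft_nonneg y]
  have h1 : 0 ≤ (edgeRight y - t) * (t - edgeLeft y) := (sq_nonneg ε).trans (le_mul_edge hε ht)
  have h2 := Real.mul_self_sqrt h1
  rw [limitStieltjes, Complex.normSq_mk]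
  field_simp
  rw [Real.sq_sqrt h1, edge_identity hy.le]
  ring

lemma norm_limitStieltjes_le {y ε t : ℝ} (hy : 0 < y) (hε : 0 < ε)
    (ht : t ∈ Set.Icc (edgeLeft y + ε) (edgeRight y - ε)) :
    ‖limitStieltjes y t‖ ≤ 1 + 1 / ε := by
  have h := mul_normSq_limitStieltjes hy hε ht
  have ht0 : ε ≤ t := by linarith [ht.1, edgeLeft_nonneg y]
  rw [Complex.normSq_eq_norm_sq] at h
  set A := ‖limitStieltjes y t‖
  have hA : A ^ 2 ≤ 1 / ε := by
    rw [le_div_iff₀ hε]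
    nlinarith [sq_nonneg A]
  nlinarith [sq_nonneg (A - 1)]

/-- The two roots of the limiting equation are complex conjugate. -/
lemma quadratic_factor {y ε t : ℝ} (hy : 0 < y) (hε : 0 < ε)
    (ht : t ∈ Set.Icc (edgeLeft y + ε) (edgeRight y - ε)) (h : ℂ) :
    (t : ℂ) * ((h - limitStieltjes y t) * (h - star (limitStieltjes y t))) =
      t * h ^ 2 + (t + 1 - y) * h + 1 := by
  have ht0 : 0 < t := by linarith [ht.1, edgeLeft_nonneg y]
  have h1 : (t : ℂ) * (limitStieltjes y t * star (limitStieltjes y t)) = 1 := by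
    have : limitStieltjes y t * star (limitStieltjes y t) =
        (Complex.normSq (limitStieltjes y t) : ℂ) := Complex.mul_conj _
    rw [this]
    exact_mod_cast mul_normSq_limitStieltjes hy hε ht
  have h2 : (t : ℂ) * (limitStieltjes y t + star (limitStieltjes y t)) = -(t + 1 - y) := by
    have : limitStieltjes y t + star (limitStieltjes y t) =
        ((2 * (limitStieltjes y t).re : ℝ) : ℂ) := Complex.add_conj _
    rw [this]
    have h3 : t * (2 * (limitStieltjes y t).re) = -(t + 1 - y) := by
      simp only [limitStieltjes]
      field_simp
    exact_mod_cast h3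
  linear_combination h1 - h * h2

/-- Stability of the quadratic equation: in the bulk the two roots at `t` are separated by the real
axis, so an approximate solution at `t + iη` in the upper half plane is close to the upper root. -/
lemma norm_sub_limitStieltjes_le {y ε : ℝ} (hy : 0 < y) (hy1 : y ≤ 1) (hε : 0 < ε) :
    ∃ C η₀ : ℝ, 0 < C ∧ 0 < η₀ ∧ ∀ t ∈ Set.Icc (edgeLeft y + ε) (edgeRight y - ε), ∀ η : ℝ, 0 < η →
      η ≤ η₀ → ∀ z : ℂ, z = t + η * Complex.I → ∀ h : ℂ, 0 ≤ h.im →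
      ‖h - limitStieltjes y t‖ ≤ C * (‖z * h ^ 2 + (z + 1 - y) * h + 1‖ + η) := by
  set A₀ : ℝ := 1 + 1 / ε with hA₀
  have hA₀pos : 0 < A₀ := by positivity
  set κ : ℝ := ε / 8 with hκ
  have hκpos : 0 < κ := by positivity
  set B : ℝ := A₀ * (3 * A₀ + 1) with hB
  have hBpos : 0 < B := by positivity
  refine ⟨2 / (ε * κ) * (1 + B), κ * ε / (2 * (κ + 2 * A₀ + 1)), by positivity, by positivity, ?_⟩
  intro t ht η hη hη₀ z hz h him
  set s := limitStieltjes y t with hs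
  have ht0 : ε ≤ t := by linarith [ht.1, edgeLeft_nonneg y]
  have hA : ‖s‖ ≤ A₀ := norm_limitStieltjes_le hy hε ht
  have hκs : κ ≤ s.im := le_limitStieltjes_im hy1 hε ht
  set e : ℂ := z * h ^ 2 + (z + 1 - y) * h + 1 with he
  set d := ‖h - s‖ with hd
  set d' := ‖h - star s‖ with hd'
  have hd0 : 0 ≤ d := norm_nonneg _
  have hκd' : κ ≤ d' := by
    have h1 := (le_abs_self _).trans (Complex.abs_im_le_norm (h - star s))
    have h2 : (h - star s).im = h.im + s.im := by simp
    rw [h2] at h1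
    linarith
  have hd'd : d' ≤ d + 2 * A₀ := by
    have h1 : h - star s = (h - s) + s - star s := by ring
    have h2 := norm_sub_le ((h - s) + s) (star s)
    have h3 := norm_add_le (h - s) s
    rw [norm_star] at h2
    rw [hd', h1]
    linarith
  have hh1 : ‖h‖ ≤ d + A₀ := by
    have := norm_add_le (h - s) s
    rw [sub_add_cancel] at this
    linarith
  have hh2 : ‖h + 1‖ ≤ d' + A₀ + 1 := by
    have h1 := norm_add_le (h - star s) (star s)
    rw [sub_add_cancel, norm_star] at h1
    have h2 := norm_add_le h 1
    rw [norm_one] at h2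
    linarith
  -- moving from `z = t + iη` to `t` costs `η |h| |h + 1|`, and `|h|` is bounded through `d` and `d'`
  have hmain : t * (d * d') ≤ ‖e‖ + η * ((d + A₀) * (d' + A₀ + 1)) := by
    have h1 := quadratic_factor hy hε ht h
    have h2 : (t : ℂ) * ((h - s) * (h - star s)) = e - (η * Complex.I) * (h * (h + 1)) := by
      rw [h1, he, hz]
      ring
    have h3 := congrArg norm h2
    rw [norm_mul, norm_mul, Complex.norm_real, Real.norm_of_nonneg (by linarith)] at h3
    rw [h3]
    refine (norm_sub_le _ _).trans ?_
    rw [norm_mul, norm_mul, norm_mul, Complex.norm_real, Complex.norm_I, mul_one,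
      Real.norm_of_nonneg hη.le]
    gcongr
  have hηbound : η * (κ + 2 * A₀ + 1) ≤ κ * ε / 2 := by
    rw [le_div_iff₀ (by positivity)] at hη₀
    linarith
  set D := d * d' with hD
  have hD0 : 0 ≤ D := by positivity
  have hκd : κ * d ≤ D := by rw [hD, mul_comm]; exact mul_le_mul_of_nonneg_left hκd' hd0
  have hκd'2 : κ * d' ≤ D + 2 * A₀ * κ := by nlinarith
  -- for small `η` this cost is absorbed by the left-hand side, up to a multiple of `η`
  have hexp : κ * ((d + A₀) * (d' + A₀ + 1)) ≤ D * (κ + 2 * A₀ + 1) + κ * B := by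
    have : κ * ((d + A₀) * (d' + A₀ + 1)) = κ * D + (A₀ + 1) * (κ * d) + A₀ * (κ * d') +
        κ * (A₀ * (A₀ + 1)) := by rw [hD]; ring
    rw [this, hB]
    nlinarith [mul_le_mul_of_nonneg_left hκd (by positivity : 0 ≤ A₀ + 1),
      mul_le_mul_of_nonneg_left hκd'2 hA₀pos.le]
  have h5 : κ * ε * D ≤ κ * ‖e‖ + (κ * ε / 2) * D + η * (κ * B) := by
    have h6 : κ * (t * D) ≤ κ * (‖e‖ + η * ((d + A₀) * (d' + A₀ + 1))) :=
      mul_le_mul_of_nonneg_left hmain hκpos.le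
    have h7 := mul_le_mul_of_nonneg_left hexp hη.le
    have h8 := mul_le_mul_of_nonneg_right hηbound hD0
    have h9 : κ * ε * D ≤ κ * (t * D) := by
      rw [mul_assoc]
      exact mul_le_mul_of_nonneg_left (mul_le_mul_of_nonneg_right ht0 hD0) hκpos.le
    linarith
  have h10 : ε * D ≤ 2 * (‖e‖ + η * B) := by
    have : κ * (ε * D) ≤ κ * (2 * (‖e‖ + η * B)) := by linarith
    exact le_of_mul_le_mul_left this hκpos
  have h11 : ε * κ * d ≤ 2 * (‖e‖ + η * B) := by
    have := mul_le_mul_of_nonneg_left hκd hε.le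
    linarith
  have h12 : d ≤ 2 * (‖e‖ + η * B) / (ε * κ) := by
    rw [le_div_iff₀ (by positivity)]
    linarith
  refine h12.trans ?_
  rw [div_mul_eq_mul_div, div_mul_eq_mul_div]
  gcongr ?_ / _
  have := mul_nonneg (norm_nonneg e) hBpos.le
  nlinarith

end Stability
/-! ### Eigenvalue counts and Poisson smoothing -/

section Counting

lemma ordConnected_ae_eq_Icc {I : Set ℝ} (hI : I.OrdConnected) (hne : I.Nonempty)
    (hb : BddBelow I) (ha : BddAbove I) :
    I =ᵐ[volume] Set.Icc (sInf I) (sSup I) := by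
  have h1 : I ⊆ Set.Icc (sInf I) (sSup I) := fun x hx => ⟨csInf_le hb hx, le_csSup ha hx⟩
  have h2 : Set.Ioo (sInf I) (sSup I) ⊆ I := by
    intro x hx
    obtain ⟨u, hu, hux⟩ := exists_lt_of_csInf_lt hne hx.1
    obtain ⟨v, hv, hvx⟩ := exists_lt_of_lt_csSup hne hx.2
    exact hI.out hu hv ⟨hux.le, hvx.le⟩
  exact h1.eventuallyLE.antisymm (Ioo_ae_eq_Icc.symm.le.trans h2.eventuallyLE)

lemma integral_poisson (α β x : ℝ) {η : ℝ} (hη : 0 < η) :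
    ∫ t in α..β, η / ((x - t) ^ 2 + η ^ 2) =
      Real.arctan ((β - x) / η) - Real.arctan ((α - x) / η) := by
  refine intervalIntegral.integral_eq_sub_of_hasDerivAt (f := fun t => Real.arctan ((t - x) / η))
    (fun t _ => ?_) ?_
  · have h1 : HasDerivAt (fun t => (t - x) / η) (1 / η) t :=
      ((hasDerivAt_id t).sub_const x).div_const η
    have h2 : (x - t) ^ 2 + η ^ 2 ≠ 0 := by positivity
    have h3 : 1 + ((t - x) / η) ^ 2 ≠ 0 := by positivity
    have h4 : η / ((x - t) ^ 2 + η ^ 2) = 1 / (1 + ((t - x) / η) ^ 2) * (1 / η) := by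
      field_simp
      ring
    rw [h4]
    exact h1.arctan
  · refine Continuous.intervalIntegrable ?_ _ _
    refine continuous_const.div (by fun_prop) fun t => ?_
    positivity

lemma arctan_le_self {u : ℝ} (hu : 0 ≤ u) : Real.arctan u ≤ u := by
  have := Real.le_tan (Real.arctan_nonneg.mpr hu) (Real.arctan_lt_pi_div_two u)
  rwa [Real.tan_arctan] at this

lemma pi_div_two_sub_arctan_le {u r : ℝ} (hr : 0 < r) (hu : r ≤ u) :
    Real.pi / 2 - Real.arctan (u / r ^ 2) ≤ r := by
  have hu0 : 0 < u := hr.trans_le hu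
  rw [← Real.arctan_inv_of_pos (by positivity)]
  refine (arctan_le_self (by positivity)).trans ?_
  rw [inv_div, div_le_iff₀ hu0, sq]
  exact mul_le_mul_of_nonneg_left hu hr.le

lemma one_le_two_mul_poisson {r s : ℝ} (hr : 0 < r) (hs : |s| < r) :
    1 ≤ 2 * r * (r / (s ^ 2 + r ^ 2)) := by
  rw [← mul_div_assoc, le_div_iff₀ (by positivity)]
  have := sq_lt_sq' (by linarith [(abs_lt.mp hs).1]) (abs_lt.mp hs).2
  nlinarith

/-- The indicator of an interval is approximated by its Poisson smoothing at scale `r²`, except at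
points within `r` of an end point, which are in turn detected by a Poisson kernel at scale `r`. -/
lemma abs_indicator_sub_poisson_le {I : Set ℝ} (hI : I.OrdConnected) (hne : I.Nonempty)
    (hb : BddBelow I) (ha : BddAbove I) {r : ℝ} (hr : 0 < r) (x : ℝ) :
    |I.indicator (fun _ => (1 : ℝ)) x -
        Real.pi⁻¹ * ∫ t in I, r ^ 2 / ((x - t) ^ 2 + (r ^ 2) ^ 2)| ≤
      r + 2 * r * (r / ((x - sInf I) ^ 2 + r ^ 2)) + 2 * r * (r / ((x - sSup I) ^ 2 + r ^ 2)) := by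
  have hαβ : sInf I ≤ sSup I := (csInf_le hb hne.some_mem).trans (le_csSup ha hne.some_mem)
  have hsub : ∀ x, x ∈ I → sInf I ≤ x ∧ x ≤ sSup I := fun x hx => ⟨csInf_le hb hx, le_csSup ha hx⟩
  have hsup : ∀ x, sInf I < x → x < sSup I → x ∈ I := by
    intro x h1 h2
    obtain ⟨u, hu, hux⟩ := exists_lt_of_csInf_lt hne h1
    obtain ⟨v, hv, hvx⟩ := exists_lt_of_lt_csSup hne h2
    exact hI.out hu hv ⟨hux.le, hvx.le⟩
  rw [setIntegral_congr_set (ordConnected_ae_eq_Icc hI hne hb ha), integral_Icc_eq_integral_Ioc,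
    ← intervalIntegral.integral_of_le hαβ, integral_poisson _ _ _ (by positivity)]
  set α := sInf I
  set β := sSup I
  have hpi : 3 < Real.pi := Real.pi_gt_three
  have hpi0 : 0 < Real.pi := Real.pi_pos
  set u := Real.arctan ((β - x) / r ^ 2) with hu
  set v := Real.arctan ((α - x) / r ^ 2) with hv
  have huv : v ≤ u := Real.arctan_le_arctan_iff.mpr (by gcongr)
  have hu1 := Real.arctan_lt_pi_div_two ((β - x) / r ^ 2)
  have hu2 := Real.neg_pi_div_two_lt_arctan ((β - x) / r ^ 2)
  have hv1 := Real.arctan_lt_pi_div_two ((α - x) / r ^ 2)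
  have hv2 := Real.neg_pi_div_two_lt_arctan ((α - x) / r ^ 2)
  rw [← hu] at hu1 hu2
  rw [← hv] at hv1 hv2
  have hP1 : 0 ≤ 2 * r * (r / ((x - α) ^ 2 + r ^ 2)) := by positivity
  have hP2 : 0 ≤ 2 * r * (r / ((x - β) ^ 2 + r ^ 2)) := by positivity
  have hw0 : 0 ≤ Real.pi⁻¹ * (u - v) := mul_nonneg (by positivity) (by linarith)
  have hw1 : Real.pi⁻¹ * (u - v) ≤ 1 := by
    rw [inv_mul_le_iff₀ hpi0]
    linarith
  have hind : I.indicator (fun _ => (1 : ℝ)) x = 0 ∨ I.indicator (fun _ => (1 : ℝ)) x = 1 := by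
    by_cases h : x ∈ I <;> simp [h]
  have htriv : |I.indicator (fun _ => (1 : ℝ)) x - Real.pi⁻¹ * (u - v)| ≤ 1 := by
    rw [abs_le]
    rcases hind with h | h <;> rw [h] <;> constructor <;> linarith
  by_cases h1 : |x - α| < r
  · have := one_le_two_mul_poisson hr h1
    linarith
  by_cases h2 : |x - β| < r
  · have := one_le_two_mul_poisson hr h2
    linarith
  push Not at h1 h2
  -- away from the end points both arctangents are within `r` of `± π / 2`
  suffices h : |I.indicator (fun _ => (1 : ℝ)) x - Real.pi⁻¹ * (u - v)| ≤ r by linarith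
  have hfin : ∀ w : ℝ, w ≤ 2 * r → Real.pi⁻¹ * w ≤ r := by
    intro w hw
    rw [inv_mul_le_iff₀ hpi0]
    nlinarith
  rcases le_abs.mp h1 with h1 | h1
  · rcases le_abs.mp h2 with h2 | h2
    · have hx : x ∉ I := fun hx => by linarith [(hsub x hx).2]
      rw [Set.indicator_of_notMem hx, zero_sub, abs_neg, abs_of_nonneg hw0]
      refine hfin _ ?_
      have e : v = -Real.arctan ((x - α) / r ^ 2) := by
        rw [hv, ← Real.arctan_neg]; congr 1; ring
      have := pi_div_two_sub_arctan_le hr h1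
      have e' : u = -Real.arctan ((x - β) / r ^ 2) := by
        rw [hu, ← Real.arctan_neg]; congr 1; ring
      have := pi_div_two_sub_arctan_le hr h2
      linarith
    · have hx : x ∈ I := hsup x (by linarith) (by linarith)
      rw [Set.indicator_of_mem hx, abs_of_nonneg (by linarith)]
      have h3 : 1 - Real.pi⁻¹ * (u - v) = Real.pi⁻¹ * (Real.pi - (u - v)) := by
        field_simp
      rw [h3]
      refine hfin _ ?_
      have e : v = -Real.arctan ((x - α) / r ^ 2) := by
        rw [hv, ← Real.arctan_neg]; congr 1; ring
      have h4 := pi_div_two_sub_arctan_le hr h1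
      have h5 := pi_div_two_sub_arctan_le hr h2
      rw [show -(x - β) = β - x by ring] at h5
      linarith
  · have hx : x ∉ I := fun hx => by linarith [(hsub x hx).1]
    rw [Set.indicator_of_notMem hx, zero_sub, abs_neg, abs_of_nonneg hw0]
    refine hfin _ ?_
    have h4 := pi_div_two_sub_arctan_le hr h1
    rw [show -(x - α) = α - x by ring] at h4
    linarith

variable {p n : ℕ}

/-- As `W` has rank at most `p`, only its `p` largest eigenvalues can be nonzero. -/
lemma lt_of_eigenvalues₀_pos (M : Matrix (Fin p) (Fin n) ℂ)
    (k : Fin (Fintype.card (Fin n))) (hk : 0 < (covMatrix_isHermitian M).eigenvalues₀ k) :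
    (k : ℕ) < p := by
  set hA := covMatrix_isHermitian M
  have hrank : (covMatrix M).rank ≤ p := by
    unfold covMatrix
    rw [← Matrix.mul_smul]
    refine (Matrix.rank_mul_le_left _ _).trans ?_
    simpa using Matrix.rank_le_width Mᴴ
  rw [hA.rank_eq_card_non_zero_eigs] at hrank
  let f : Fin (k + 1) → {i // hA.eigenvalues i ≠ 0} := fun j =>
    ⟨Fintype.equivOfCardEq (Fintype.card_fin _) ⟨j, by omega⟩, by
      have h1 : hA.eigenvalues (Fintype.equivOfCardEq (Fintype.card_fin _)
          (⟨j, by omega⟩ : Fin (Fintype.card (Fin n)))) = hA.eigenvalues₀ ⟨j, by omega⟩ := by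
        simp [Matrix.IsHermitian.eigenvalues]
      rw [h1]
      refine (hk.trans_le (hA.eigenvalues₀_antitone ?_)).ne'
      exact Nat.lt_succ_iff.mp j.2⟩
  have hf : Function.Injective f := by
    intro a b hab
    have := congrArg Subtype.val hab
    simp only [f, EmbeddingLike.apply_eq_iff_eq, Fin.mk.injEq] at this
    exact Fin.ext this
  have := Fintype.card_le_of_injective f hf
  rw [Fintype.card_fin] at this
  omega

/-- Away from zero the trivial eigenvalues are not seen, and the nontrivial eigenvalues may be
counted among all eigenvalues of `W`. -/
lemma eigenvalueCount_eq_sum (hpn : p ≤ n) (M : Matrix (Fin p) (Fin n) ℂ) {I : Set ℝ}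
    (hI : I ⊆ Set.Ioi 0) :
    (eigenvalueCount hpn M I : ℝ) =
      ∑ k, I.indicator (fun _ => (1 : ℝ)) ((covMatrix_isHermitian M).eigenvalues k) := by
  classical
  set hA := covMatrix_isHermitian M
  set g : Fin p → Fin (Fintype.card (Fin n)) := fun i =>
    Fin.cast (Fintype.card_fin n).symm (Fin.castLE hpn i.rev) with hg
  have hginj : Function.Injective g := by
    intro a b hab
    simp only [hg, Fin.ext_iff, Fin.val_cast, Fin.val_castLE, Fin.val_rev] at hab
    exact Fin.ext (by omega)
  have h1 : eigenvalueCount hpn M I = Set.ncard {k | hA.eigenvalues₀ k ∈ I} := by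
    have h2 : {i : Fin p | eigenvalue hpn M i ∈ I} = g ⁻¹' {k | hA.eigenvalues₀ k ∈ I} := rfl
    rw [eigenvalueCount, h2]
    refine Set.ncard_preimage_of_injective_subset_range hginj fun k hk => ?_
    have hkp := lt_of_eigenvalues₀_pos M k (hI hk)
    refine ⟨Fin.rev ⟨k, hkp⟩, ?_⟩
    simp [hg]
  have h3 : Set.ncard {k | hA.eigenvalues₀ k ∈ I} = Set.ncard {i | hA.eigenvalues i ∈ I} := by
    have h4 : {i | hA.eigenvalues i ∈ I} = (Fintype.equivOfCardEq (Fintype.card_fin _)).symm ⁻¹'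
      {k | hA.eigenvalues₀ k ∈ I} := rfl
    rw [h4]
    exact (Set.ncard_preimage_of_injective_subset_range (Equiv.injective _)
      (by simp)).symm
  rw [h1, h3, Set.ncard_eq_toFinset_card']
  simp [Set.indicator_apply, Finset.sum_boole, Set.toFinset_ofPred]

lemma im_stieltjes_eq_sum (X : Fin p → Fin n → ℂ) (t : ℝ) {η : ℝ} (hη : 0 < η) :
    (stieltjes (t + η * Complex.I) X).im = (n : ℝ)⁻¹ * ∑ k,
      η / (((covMatrix_isHermitian (Matrix.of X)).eigenvalues k - t) ^ 2 + η ^ 2) := by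
  rw [stieltjes_eq_sum (by simpa using hη), ← Complex.ofReal_natCast, ← Complex.ofReal_inv,
    Complex.im_ofReal_mul, Complex.im_sum]
  congr 1
  refine Finset.sum_congr rfl fun k _ => ?_
  rw [Complex.inv_im, Complex.normSq_apply]
  simp
  ring

/-- The smoothed eigenvalue counting function `(1/π) ∫_I Im h(t + iη) dt`. -/
noncomputable def smoothedCount (η : ℝ) (I : Set ℝ) (X : Fin p → Fin n → ℂ) : ℝ :=
  Real.pi⁻¹ * ∫ t in I, (stieltjes (t + η * Complex.I) X).im

lemma abs_eigenvalueCount_sub_smoothedCount_le (hpn : p ≤ n) (hn : 0 < n) (X : Fin p → Fin n → ℂ)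
    {I : Set ℝ} (hI : I.OrdConnected) (hne : I.Nonempty) {l u : ℝ} (hl : 0 < l)
    (hIlu : I ⊆ Set.Icc l u) {r : ℝ} (hr : 0 < r) :
    |(eigenvalueCount hpn (Matrix.of X) I : ℝ) / n - smoothedCount (r ^ 2) I X| ≤
      r + 2 * r * ((stieltjes ((sInf I : ℝ) + r * Complex.I) X).im +
        (stieltjes ((sSup I : ℝ) + r * Complex.I) X).im) := by
  have hn' : (0 : ℝ) < n := by exact_mod_cast hn
  have hb : BddBelow I := ⟨l, fun x hx => (hIlu hx).1⟩
  have ha : BddAbove I := ⟨u, fun x hx => (hIlu hx).2⟩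
  have hr2 : 0 < r ^ 2 := by positivity
  set ev := (covMatrix_isHermitian (Matrix.of X)).eigenvalues with hev
  have hvol : volume I < ⊤ := (measure_mono hIlu).trans_lt (by simp)
  have h1 : smoothedCount (r ^ 2) I X = (n : ℝ)⁻¹ * ∑ k, Real.pi⁻¹ * ∫ t in I,
      r ^ 2 / ((ev k - t) ^ 2 + (r ^ 2) ^ 2) := by
    have e := fun t => im_stieltjes_eq_sum X t hr2
    unfold smoothedCount
    simp_rw [e]
    rw [integral_const_mul, integral_finsetSum, ← Finset.mul_sum]
    · ring
    · intro k _
      refine IntegrableOn.mono_set (t := Set.Icc l u) ?_ hIlu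
      refine ContinuousOn.integrableOn_Icc (Continuous.continuousOn ?_)
      refine continuous_const.div (by fun_prop) fun t => ?_
      positivity
  rw [eigenvalueCount_eq_sum hpn _ fun x hx => hl.trans_le (hIlu hx).1, h1, div_eq_inv_mul,
    ← mul_sub, ← Finset.sum_sub_distrib, abs_mul, abs_of_pos (by positivity), im_stieltjes_eq_sum _ _ hr,
    im_stieltjes_eq_sum _ _ hr, inv_mul_le_iff₀ hn']
  refine (Finset.abs_sum_le_sum_abs _ _).trans ((Finset.sum_le_sum fun k _ =>
    abs_indicator_sub_poisson_le hI hne hb ha hr (ev k)).trans (le_of_eq ?_))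
  rw [Finset.sum_add_distrib, Finset.sum_add_distrib, ← Finset.mul_sum, ← Finset.mul_sum]
  simp only [Finset.sum_const, Finset.card_univ, Fintype.card_fin, nsmul_eq_mul]
  field_simp
  ring

end Counting
/-! ### Means and bounded differences of the statistics -/

section Expectation

variable {p n : ℕ} {Ω : Type*} [MeasurableSpace Ω] {P : Measure Ω}

/-- Bound for the expected error in the limiting quadratic equation at distance `η` from the real
axis, where `κ` bounds `K² / n` and `q = p / n`. -/
noncomputable def quadraticError (κ : ℝ) (n : ℕ) (q y η : ℝ) : ℝ :=
  5 / η * (√(3 * κ / η ^ 2) + (n * η)⁻¹) + |q - y| / η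

lemma bulk_bounds {y ε t : ℝ} (hy1 : y ≤ 1) (hε : 0 < ε)
    (ht : t ∈ Set.Icc (edgeLeft y + ε) (edgeRight y - ε)) : 0 < t ∧ t ≤ 4 :=
  ⟨by linarith [ht.1, edgeLeft_nonneg y], by linarith [ht.2, edgeRight_le_four hy1]⟩

lemma memLp_stieltjes {X : Ω → Fin p → Fin n → ℂ} (hX : Measurable X) (t : ℝ) {η : ℝ}
    (hη : 0 < η) : MemLp (fun ω => stieltjes (t + η * Complex.I) (X ω)) ⊤ P :=
  memLp_top_of_bound ((continuous_stieltjes_snd t hη).measurable.comp hX).aestronglyMeasurable η⁻¹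
    (ae_of_all _ fun ω => by
      have := norm_stieltjes_le (z := t + η * Complex.I) (by simpa using hη) (X ω)
      simpa using this)

lemma integral_norm_stieltjes_sub_limit_le [IsProbabilityMeasure P] {X : Ω → Fin p → Fin n → ℂ}
    {K : ℝ} (hX : BoundedStandard (fun (ij : Fin p × Fin n) ω => X ω ij.1 ij.2) P K) (hK : 1 ≤ K)
    (hn : 0 < n) (hpn : p ≤ n) {y ε C η₀ η κ : ℝ} (hy1 : y ≤ 1) (hε : 0 < ε) (hC : 0 ≤ C)
    (hstab : ∀ t ∈ Set.Icc (edgeLeft y + ε) (edgeRight y - ε), ∀ η : ℝ, 0 < η →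
      η ≤ η₀ → ∀ z : ℂ, z = t + η * Complex.I → ∀ h : ℂ, 0 ≤ h.im →
      ‖h - limitStieltjes y t‖ ≤ C * (‖z * h ^ 2 + (z + 1 - y) * h + 1‖ + η))
    (hη : 0 < η) (hη₀ : η ≤ η₀) (hη1 : η ≤ 1) (hκ : K ^ 2 / n ≤ κ)
    {t : ℝ} (ht : t ∈ Set.Icc (edgeLeft y + ε) (edgeRight y - ε)) :
    ∫ ω, ‖stieltjes (t + η * Complex.I) (X ω) - limitStieltjes y t‖ ∂P ≤
      C * (quadraticError κ n (p / n) y η + η) := by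
  have hXm : Measurable X :=
    measurable_pi_lambda _ fun a => measurable_pi_lambda _ fun b => hX.measurable (a, b)
  set z : ℂ := t + η * Complex.I with hz
  have hzim : z.im = η := by simp [hz]
  have hzn : ‖z‖ ≤ 5 := by
    obtain ⟨h1, h2⟩ := bulk_bounds hy1 hε ht
    refine (norm_add_le _ _).trans ?_
    rw [norm_mul, Complex.norm_I, Complex.norm_real, Complex.norm_real, Real.norm_of_nonneg h1.le,
      Real.norm_of_nonneg hη.le]
    linarith
  have hn' : (0 : ℝ) < n := by exact_mod_cast hn
  set e : Ω → ℂ := fun ω =>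
    z * stieltjes z (X ω) ^ 2 + (z + 1 - (p / n : ℝ)) * stieltjes z (X ω) + 1 with he
  have hmem : MemLp (fun ω => stieltjes z (X ω)) ⊤ P := memLp_stieltjes hXm t hη
  have hemem : MemLp e ⊤ P := by
    simp only [he, sq]
    exact (((memLp_top_mul hmem hmem).const_mul z).add (hmem.const_mul _)).add (memLp_const 1)
  have hpt : ∀ ω, ‖stieltjes z (X ω) - limitStieltjes y t‖ ≤
      C * (‖e ω‖ + |(p / n : ℝ) - y| / η + η) := by
    intro ω
    refine (hstab t ht η hη hη₀ z hz _ (stieltjes_im_nonneg (by rw [hzim]; exact hη) _)).trans ?_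
    gcongr
    have h1 : z * stieltjes z (X ω) ^ 2 + (z + 1 - y) * stieltjes z (X ω) + 1 =
        e ω + (((p / n : ℝ) - y : ℝ) : ℂ) * stieltjes z (X ω) := by
      simp only [he]
      push_cast
      ring
    rw [h1]
    refine (norm_add_le _ _).trans ?_
    have h2 := norm_stieltjes_le (z := z) (by rw [hzim]; exact hη) (X ω)
    rw [hzim] at h2
    rw [norm_mul, Complex.norm_real, Real.norm_eq_abs, div_eq_mul_inv |(p / n : ℝ) - y|]
    gcongr
  have hei : Integrable (fun ω => ‖e ω‖) P := (integrable_of_memLp_top hemem).norm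
  refine (integral_mono_of_nonneg (ae_of_all _ fun ω => norm_nonneg _)
    (((hei.add (integrable_const _)).add (integrable_const _)).const_mul C)
    (ae_of_all _ hpt)).trans ?_
  rw [integral_const_mul, integral_add' (hei.add (integrable_const _)) (integrable_const _),
    integral_add' hei (integrable_const _)]
  simp only [integral_const, probReal_univ, one_smul]
  have h2 := integral_norm_quadratic_le hX hK hn hpn t hη hz
  unfold quadraticError
  gcongr
  refine h2.trans ?_
  have h3 : 3 * K ^ 2 / (n * η ^ 2) ≤ 3 * κ / η ^ 2 := by
    rw [← div_div, mul_div_assoc]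
    gcongr
  gcongr

lemma measurable_smoothedCount {η : ℝ} (hη : 0 < η) (I : Set ℝ) :
    Measurable (smoothedCount (p := p) (n := n) η I) := by
  have h1 : Continuous fun q : (Fin p → Fin n → ℂ) × ℝ =>
      (stieltjes (q.2 + η * Complex.I) q.1).im := by
    have h0 : Continuous fun q : (Fin p → Fin n → ℂ) × ℝ => (q.2, q.1) := by fun_prop
    have h := (continuous_stieltjes (p := p) (n := n) hη).comp h0
    exact Complex.continuous_im.comp (by simpa only [Function.comp_def] using h)
  have h2 : StronglyMeasurable fun X : Fin p → Fin n → ℂ => ∫ t in I,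
      (stieltjes (t + η * Complex.I) X).im :=
    h1.stronglyMeasurable.integral_prod_right' (ν := volume.restrict I)
  exact h2.measurable.const_mul _

lemma abs_im_stieltjes_le (t : ℝ) {η : ℝ} (hη : 0 < η) (X : Fin p → Fin n → ℂ) :
    |(stieltjes (t + η * Complex.I) X).im| ≤ η⁻¹ := by
  have := norm_stieltjes_le (z := t + η * Complex.I) (by simpa using hη) X
  exact (Complex.abs_im_le_norm _).trans (by simpa using this)

lemma abs_im_stieltjes_sub_update_le (t : ℝ) {η : ℝ} (hη : 0 < η) (X : Fin p → Fin n → ℂ)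
    (i : Fin p) (x : Fin n → ℂ) :
    |(stieltjes (t + η * Complex.I) X).im -
      (stieltjes (t + η * Complex.I) (Function.update X i x)).im| ≤ 2 * (n * η)⁻¹ := by
  have := norm_stieltjes_sub_update_le (z := t + η * Complex.I) (by simpa using hη) X i x
  rw [← Complex.sub_im]
  exact (Complex.abs_im_le_norm _).trans (by simpa using this)

lemma integrableOn_im_stieltjes {η : ℝ} (hη : 0 < η) {I : Set ℝ} {l u : ℝ}
    (hI : I ⊆ Set.Icc l u) (X : Fin p → Fin n → ℂ) :
    IntegrableOn (fun t : ℝ => (stieltjes (t + η * Complex.I) X).im) I := by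
  have h1 : Continuous fun t : ℝ => (stieltjes (t + η * Complex.I) X).im := by
    have h0 : Continuous fun t : ℝ => (t, X) := by fun_prop
    have h := (continuous_stieltjes (p := p) (n := n) hη).comp h0
    exact Complex.continuous_im.comp (by simpa only [Function.comp_def] using h)
  exact h1.continuousOn.integrableOn_Icc.mono_set hI

lemma volume_bulk_le {y ε : ℝ} (hy1 : y ≤ 1) (hε : 0 < ε) {I : Set ℝ}
    (hI : I ⊆ Set.Icc (edgeLeft y + ε) (edgeRight y - ε)) :
    volume I < ⊤ ∧ volume.real I ≤ 4 := by
  have h1 : I ⊆ Set.Icc 0 4 := fun x hx => by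
    have := bulk_bounds hy1 hε (hI hx)
    exact ⟨this.1.le, this.2⟩
  refine ⟨(measure_mono h1).trans_lt (by simp), ?_⟩
  have := measureReal_mono (μ := volume) h1 (by simp)
  simpa using this

lemma inv_pi_mul_le {V c : ℝ} (hV : V ≤ 4) (hc : 0 ≤ c) : Real.pi⁻¹ * (c * V) ≤ 2 * c := by
  rw [inv_mul_le_iff₀ Real.pi_pos]
  nlinarith [Real.pi_gt_three]

lemma abs_smoothedCount_le {η : ℝ} (hη : 0 < η) {I : Set ℝ} (hfin : volume I < ⊤)
    (hvol : volume.real I ≤ 4) (X : Fin p → Fin n → ℂ) :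
    |smoothedCount η I X| ≤ 2 * η⁻¹ := by
  unfold smoothedCount
  rw [abs_mul, abs_of_pos (by positivity)]
  have := norm_setIntegral_le_of_norm_le_const (μ := volume) (s := I) hfin (C := η⁻¹)
    (f := fun t : ℝ => (stieltjes (t + η * Complex.I) X).im) fun t _ => abs_im_stieltjes_le t hη X
  exact (mul_le_mul_of_nonneg_left this (by positivity)).trans (inv_pi_mul_le hvol (by positivity))

lemma abs_smoothedCount_sub_update_le {η : ℝ} (hη : 0 < η) {I : Set ℝ} {l u : ℝ}
    (hI : I ⊆ Set.Icc l u) (hvol : volume.real I ≤ 4) (X : Fin p → Fin n → ℂ)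
    (i : Fin p) (x : Fin n → ℂ) :
    |smoothedCount η I X - smoothedCount η I (Function.update X i x)| ≤ 4 * (n * η)⁻¹ := by
  have hfin : volume I < ⊤ := (measure_mono hI).trans_lt (by simp)
  unfold smoothedCount
  rw [← mul_sub, ← integral_sub (integrableOn_im_stieltjes hη hI X)
    (integrableOn_im_stieltjes hη hI _), abs_mul, abs_of_pos (by positivity)]
  have := norm_setIntegral_le_of_norm_le_const (μ := volume) (s := I) hfin (C := 2 * (n * η)⁻¹)
    (f := fun t : ℝ => (stieltjes (t + η * Complex.I) X).im -
      (stieltjes (t + η * Complex.I) (Function.update X i x)).im)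
    fun t _ => abs_im_stieltjes_sub_update_le t hη X i x
  refine (mul_le_mul_of_nonneg_left this (by positivity)).trans
    ((inv_pi_mul_le hvol (by positivity)).trans (le_of_eq (by ring)))

lemma continuousOn_limitStieltjes_im {y ε : ℝ} (hε : 0 < ε) :
    ContinuousOn (fun t => (limitStieltjes y t).im)
      (Set.Icc (edgeLeft y + ε) (edgeRight y - ε)) := by
  simp only [limitStieltjes]
  refine ContinuousOn.div (by fun_prop) (by fun_prop) fun t ht => ?_
  have : 0 < t := by linarith [ht.1, edgeLeft_nonneg y]
  positivity

/-- The mean of the smoothed counting function is close to the Marchenko-Pastur mass. -/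
lemma abs_integral_smoothedCount_sub_le [IsProbabilityMeasure P] {X : Ω → Fin p → Fin n → ℂ}
    (hX : Measurable X) {y ε η E : ℝ} (hy : 0 < y) (hy1 : y ≤ 1) (hε : 0 < ε) (hη : 0 < η)
    (hE : ∀ t ∈ Set.Icc (edgeLeft y + ε) (edgeRight y - ε),
      ∫ ω, ‖stieltjes (t + η * Complex.I) (X ω) - limitStieltjes y t‖ ∂P ≤ E)
    (hE0 : 0 ≤ E) {I : Set ℝ} (hIm : MeasurableSet I)
    (hI : I ⊆ Set.Icc (edgeLeft y + ε) (edgeRight y - ε)) :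
    |∫ ω, smoothedCount η I (X ω) ∂P - y * ∫ x in I, marchenkoPastur y x| ≤ 2 * E := by
  obtain ⟨hfin, hvol⟩ := volume_bulk_le hy1 hε hI
  have : IsFiniteMeasure (volume.restrict I) := ⟨by simpa using hfin⟩
  have hlim : IntegrableOn (fun t => (limitStieltjes y t).im) I :=
    (continuousOn_limitStieltjes_im hε).integrableOn_Icc.mono_set hI
  have hmp : y * ∫ x in I, marchenkoPastur y x =
      Real.pi⁻¹ * ∫ t in I, (limitStieltjes y t).im := by
    have : ∫ t in I, (limitStieltjes y t).im = ∫ t in I, Real.pi * y * marchenkoPastur y t := by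
      refine setIntegral_congr_fun hIm fun t ht => ?_
      exact limitStieltjes_im hy ⟨by linarith [(hI ht).1], by linarith [(hI ht).2]⟩
    rw [this, integral_const_mul]
    have := Real.pi_pos
    field_simp
  have hjoint : Integrable (Function.uncurry fun (ω : Ω) (t : ℝ) =>
      (stieltjes (t + η * Complex.I) (X ω)).im) (P.prod (volume.restrict I)) := by
    refine Integrable.of_bound ?_ η⁻¹ (ae_of_all _ fun q => abs_im_stieltjes_le q.2 hη (X q.1))
    have h1 : Measurable fun q : Ω × ℝ => (q.2, X q.1) :=
      measurable_snd.prodMk (hX.comp measurable_fst)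
    have h2 := (continuous_stieltjes (p := p) (n := n) hη).measurable.comp h1
    exact (Complex.measurable_im.comp h2).aestronglyMeasurable
  have hswap : ∫ ω, smoothedCount η I (X ω) ∂P =
      Real.pi⁻¹ * ∫ t in I, ∫ ω, (stieltjes (t + η * Complex.I) (X ω)).im ∂P := by
    unfold smoothedCount
    rw [integral_const_mul, integral_integral_swap hjoint]
  have hEint : IntegrableOn (fun t : ℝ => ∫ ω, (stieltjes (t + η * Complex.I) (X ω)).im ∂P) I :=
    hjoint.integral_prod_right
  rw [hswap, hmp, ← mul_sub, ← integral_sub hEint hlim, abs_mul, abs_of_pos (by positivity)]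
  have := norm_setIntegral_le_of_norm_le_const (μ := volume) (s := I) hfin (C := E)
    (f := fun t : ℝ => ∫ ω, (stieltjes (t + η * Complex.I) (X ω)).im ∂P - (limitStieltjes y t).im)
    fun t ht => by
      have hi : Integrable (fun ω => stieltjes (t + η * Complex.I) (X ω)) P :=
        integrable_of_memLp_top (memLp_stieltjes hX t hη)
      refine le_trans ?_ (hE t (hI ht))
      have h1 : ∫ ω, (stieltjes (t + η * Complex.I) (X ω)).im ∂P - (limitStieltjes y t).im =
          ∫ ω, (stieltjes (t + η * Complex.I) (X ω) - limitStieltjes y t).im ∂P := by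
        simp only [Complex.sub_im]
        have h2 := integral_sub hi.im (integrable_const (μ := P) (limitStieltjes y t).im)
        simp only [RCLike.im_to_complex] at h2
        rw [h2]
        simp
      rw [h1]
      refine (norm_integral_le_integral_norm _).trans
        (integral_mono ((hi.sub (integrable_const _)).im.norm) ((hi.sub (integrable_const _)).norm)
          fun ω => Complex.abs_im_le_norm _)
  exact (mul_le_mul_of_nonneg_left this (by positivity)).trans (inv_pi_mul_le hvol hE0)

lemma integral_im_stieltjes_le [IsProbabilityMeasure P] {X : Ω → Fin p → Fin n → ℂ}
    (hX : Measurable X) {η E t : ℝ} {h₀ : ℂ} (hη : 0 < η)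
    (hE : ∫ ω, ‖stieltjes (t + η * Complex.I) (X ω) - h₀‖ ∂P ≤ E) :
    ∫ ω, (stieltjes (t + η * Complex.I) (X ω)).im ∂P ≤ ‖h₀‖ + E := by
  have hi : Integrable (fun ω => stieltjes (t + η * Complex.I) (X ω)) P :=
    integrable_of_memLp_top (memLp_stieltjes hX t hη)
  have hi2 : Integrable (fun ω => ‖stieltjes (t + η * Complex.I) (X ω) - h₀‖) P :=
    (hi.sub (integrable_const h₀)).norm
  calc _ ≤ ∫ ω, (‖h₀‖ + ‖stieltjes (t + η * Complex.I) (X ω) - h₀‖) ∂P := by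
        refine integral_mono hi.im ((integrable_const _).add hi2) fun ω => ?_
        have h1 := (le_abs_self _).trans
          (Complex.abs_im_le_norm (stieltjes (t + η * Complex.I) (X ω)))
        have h2 := norm_add_le h₀ (stieltjes (t + η * Complex.I) (X ω) - h₀)
        rw [add_sub_cancel] at h2
        exact h1.trans h2
    _ ≤ _ := by
        rw [integral_add (integrable_const _) hi2]
        simpa using hE

end Expectation
/-! ### Concentration and the proof of the theorem -/

section Main

lemma tendsto_quadraticError {q κ : ℕ → ℝ} {y : ℝ} (hq : Tendsto q atTop (𝓝 y))
    (hκ : Tendsto κ atTop (𝓝 0)) {η : ℝ} (hη : 0 < η) :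
    Tendsto (fun n => quadraticError (κ n) n (q n) y η) atTop (𝓝 0) := by
  have h1 : Tendsto (fun n => √(3 * κ n / η ^ 2)) atTop (𝓝 0) := by
    have : Tendsto (fun n => √(3 * κ n / η ^ 2)) atTop (𝓝 (√(3 * 0 / η ^ 2))) :=
      (Real.continuous_sqrt.tendsto _).comp ((hκ.const_mul 3).div_const _)
    simpa using this
  have h2 : Tendsto (fun n : ℕ => ((n : ℝ) * η)⁻¹) atTop (𝓝 0) :=
    (tendsto_natCast_atTop_atTop.atTop_mul_const hη).inv_tendsto_atTop
  have h3 : Tendsto (fun n => |q n - y| / η) atTop (𝓝 0) := by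
    have := ((hq.sub_const y).abs).div_const η
    simpa using this
  have := ((h1.add h2).const_mul (5 / η)).add h3
  simpa [quadraticError] using this

/-- The concentration step and the comparison of counts at a fixed `n`, for one interval. -/
lemma measure_eigenvalueCount_deviation_le {p n : ℕ} {Ω : Type*} [MeasurableSpace Ω]
    {P : Measure Ω} [IsProbabilityMeasure P] {X : Ω → Fin p → Fin n → ℂ} {K : ℝ}
    (hX : BoundedStandard (fun (ij : Fin p × Fin n) ω => X ω ij.1 ij.2) P K)
    (hp : 0 < p) (hn : 0 < n) (hpn : p ≤ n) {y ε : ℝ} (hy : 0 < y) (hy1 : y ≤ 1)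
    (hε : 0 < ε) {I : Set ℝ} (hIo : I.OrdConnected) (hne : I.Nonempty)
    (hI : I ⊆ Set.Icc (edgeLeft y + ε) (edgeRight y - ε)) {r s E₁ E₂ : ℝ} (hr : 0 < r) (hr1 : r ≤ 1)
    (hs : 0 < s) (hs1 : s ≤ 1)
    (hE₁ : ∀ t ∈ Set.Icc (edgeLeft y + ε) (edgeRight y - ε),
      ∫ ω, ‖stieltjes (t + r * Complex.I) (X ω) - limitStieltjes y t‖ ∂P ≤ E₁)
    (hE₂ : ∀ t ∈ Set.Icc (edgeLeft y + ε) (edgeRight y - ε),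
      ∫ ω, ‖stieltjes (t + (r ^ 2 : ℝ) * Complex.I) (X ω) - limitStieltjes y t‖ ∂P ≤ E₂)
    (hE₂0 : 0 ≤ E₂) :
    1 - 6 * Real.exp (-(s ^ 2 * r ^ 4 / 32) * n) ≤
      P.real {ω | |(eigenvalueCount hpn (Matrix.of (X ω)) I : ℝ) / n -
        y * ∫ x in I, marchenkoPastur y x| ≤
        r + 4 * r * (1 + 1 / ε + E₁ + 1) + s + 2 * E₂} := by
  have hXm : Measurable X :=
    measurable_pi_lambda _ fun a => measurable_pi_lambda _ fun b => hX.measurable (a, b)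
  have hrm : ∀ i, Measurable fun ω => X ω i := fun i => (measurable_pi_apply i).comp hXm
  have hrows : iIndepFun (fun i ω => X ω i) P :=
    iIndepFun_rows (fun i j => hX.measurable (i, j)) hX.indep
  obtain ⟨hfin, hvol⟩ := volume_bulk_le hy1 hε hI
  have hr2 : 0 < r ^ 2 := by positivity
  have hn' : (0 : ℝ) < n := by exact_mod_cast hn
  have hpn' : (p : ℝ) ≤ n := by exact_mod_cast hpn
  have hclosed : ∀ e ∈ closure I, e ∈ Set.Icc (edgeLeft y + ε) (edgeRight y - ε) := fun e he =>
    closure_minimal hI isClosed_Icc he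
  have hbb : BddBelow I := bddBelow_Icc.mono hI
  have hba : BddAbove I := bddAbove_Icc.mono hI
  have hα := hclosed _ (csInf_mem_closure hne hbb)
  have hβ := hclosed _ (csSup_mem_closure hne hba)
  -- all three statistics have differences at most `4 / (n r²)`
  have htail : ∀ f : (Fin p → Fin n → ℂ) → ℝ, Measurable f → (∃ b, ∀ x, |f x| ≤ b) →
      (∀ x i v, |f x - f (Function.update x i v)| ≤ 4 * (n * r ^ 2)⁻¹) →
      P.real {ω | s ≤ |f (X ω) - ∫ ω, f (X ω) ∂P|} ≤
        2 * Real.exp (-(s ^ 2 * r ^ 4 / 32) * n) := by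
    rintro f hf ⟨b, hb⟩ hd
    refine (measure_abs_sub_integral_ge_le hrm hrows hf hb (by positivity) hd hs.le).trans ?_
    gcongr
    have hp' : (0 : ℝ) < p := by exact_mod_cast hp
    rw [neg_div, neg_mul, neg_le_neg_iff, le_div_iff₀ (by positivity)]
    have : s ^ 2 * r ^ 4 / 32 * n * (2 * (p * (4 * (n * r ^ 2)⁻¹) ^ 2)) = s ^ 2 * (p / n) := by
      field_simp
      ring
    rw [this]
    exact mul_le_of_le_one_right (by positivity) (div_le_one_of_le₀ hpn' hn'.le)
  have him : ∀ t : ℝ, P.real {ω | s ≤ |(stieltjes (t + r * Complex.I) (X ω)).im -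
      ∫ ω, (stieltjes (t + r * Complex.I) (X ω)).im ∂P|} ≤
      2 * Real.exp (-(s ^ 2 * r ^ 4 / 32) * n) := by
    intro t
    refine htail (fun x => (stieltjes (t + r * Complex.I) x).im)
      (Complex.measurable_im.comp (continuous_stieltjes_snd t hr).measurable)
      ⟨r⁻¹, abs_im_stieltjes_le t hr⟩ fun x i v => ?_
    refine (abs_im_stieltjes_sub_update_le t hr x i v).trans ?_
    gcongr
    · norm_num
    · nlinarith
  have hcount := htail (smoothedCount (r ^ 2) I) (measurable_smoothedCount hr2 I)
    ⟨_, abs_smoothedCount_le hr2 hfin hvol⟩ (abs_smoothedCount_sub_update_le hr2 hI hvol)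
  set A := {ω | s ≤ |smoothedCount (r ^ 2) I (X ω) - ∫ ω, smoothedCount (r ^ 2) I (X ω) ∂P|}
    with hA
  set B : ℝ → Set Ω := fun t => {ω | s ≤ |(stieltjes (t + r * Complex.I) (X ω)).im -
      ∫ ω, (stieltjes (t + r * Complex.I) (X ω)).im ∂P|} with hB
  have hAm : MeasurableSet A :=
    measurableSet_le measurable_const
      ((((measurable_smoothedCount hr2 I).comp hXm).sub_const _).abs)
  have hBm : ∀ t, MeasurableSet (B t) := fun t =>
    measurableSet_le measurable_const
      (((Complex.measurable_im.comp ((continuous_stieltjes_snd t hr).measurable.comp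
        hXm)).sub_const _).abs)
  have hbad : P.real (A ∪ (B (sInf I) ∪ B (sSup I))) ≤
      6 * Real.exp (-(s ^ 2 * r ^ 4 / 32) * n) := by
    have h1 := measureReal_union_le (μ := P) A (B (sInf I) ∪ B (sSup I))
    have h2 := measureReal_union_le (μ := P) (B (sInf I)) (B (sSup I))
    have h3 := him (sInf I)
    have h4 := him (sSup I)
    linarith
  have hcompl : P.real (A ∪ (B (sInf I) ∪ B (sSup I)))ᶜ =
      1 - P.real (A ∪ (B (sInf I) ∪ B (sSup I))) := by
    rw [measureReal_compl (hAm.union ((hBm _).union (hBm _)))]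
    simp
  have hmean := abs_integral_smoothedCount_sub_le hXm hy hy1 hε hr2 hE₂ hE₂0 hIo.measurableSet hI
  refine le_trans (by linarith) (hcompl.symm.le.trans (measureReal_mono ?_))
  intro ω hω
  simp only [Set.mem_compl_iff, Set.mem_union, not_or, hA, hB, Set.mem_ofPred_eq, not_le] at hω
  obtain ⟨h1, h2, h3⟩ := hω
  have hl : 0 < edgeLeft y + ε := by linarith [edgeLeft_nonneg y]
  have h4 := abs_eigenvalueCount_sub_smoothedCount_le hpn hn (X ω) hIo hne hl hI hr
  have h5 := (integral_im_stieltjes_le hXm hr (hE₁ _ hα))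
  have h6 := (integral_im_stieltjes_le hXm hr (hE₁ _ hβ))
  have h7 := norm_limitStieltjes_le hy hε hα
  have h8 := norm_limitStieltjes_le hy hε hβ
  have h9 := (abs_lt.mp h2).2
  have h10 := (abs_lt.mp h3).2
  have h11 : 2 * r * ((stieltjes ((sInf I : ℝ) + r * Complex.I) (X ω)).im +
      (stieltjes ((sSup I : ℝ) + r * Complex.I) (X ω)).im) ≤
      2 * r * (2 * (1 + 1 / ε + E₁ + 1)) := by
    gcongr
    linarith
  have h12 := abs_sub_le ((eigenvalueCount hpn (Matrix.of (X ω)) I : ℝ) / n)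
    (smoothedCount (r ^ 2) I (X ω)) (y * ∫ x in I, marchenkoPastur y x)
  have h13 := abs_sub_le (smoothedCount (r ^ 2) I (X ω))
    (∫ ω, smoothedCount (r ^ 2) I (X ω) ∂P) (y * ∫ x in I, marchenkoPastur y x)
  simp only [Set.mem_ofPred_eq]
  linarith

lemma abs_integral_marchenkoPastur_le {y ε : ℝ} (hy : 0 < y) (hy1 : y ≤ 1) (hε : 0 < ε)
    {I : Set ℝ} (hI : I ⊆ Set.Icc (edgeLeft y + ε) (edgeRight y - ε)) :
    |∫ x in I, marchenkoPastur y x| ≤ 2 * (1 + 1 / ε) / y := by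
  obtain ⟨hfin, hvol⟩ := volume_bulk_le hy1 hε hI
  have hb : ∀ x ∈ I, ‖marchenkoPastur y x‖ ≤ Real.pi⁻¹ * ((1 + 1 / ε) / y) := by
    intro x hx
    have h1 := limitStieltjes_im hy (t := x) ⟨by linarith [(hI hx).1], by linarith [(hI hx).2]⟩
    have h2 := (Complex.abs_im_le_norm _).trans (norm_limitStieltjes_le hy hε (hI hx))
    rw [h1, abs_mul, abs_of_pos (by positivity)] at h2
    rw [inv_mul_eq_div, div_div, le_div_iff₀ (by positivity), Real.norm_eq_abs]
    linarith
  refine (norm_setIntegral_le_of_norm_le_const hfin hb).trans ?_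
  rw [mul_assoc]
  refine (inv_pi_mul_le hvol (by positivity)).trans (le_of_eq (by ring))

end Main
end RandomCovariance

theorem theorem3p2
    {Ω : ℕ → Type*} [∀ n, MeasurableSpace (Ω n)]
    (P : ∀ n, Measure (Ω n)) [∀ n, IsProbabilityMeasure (P n)]
    (p : ℕ → ℕ) (hpn : ∀ n, p n ≤ n)
    (y : ℝ) (hy0 : 0 < y) (hy1 : y ≤ 1)
    (hlim : Tendsto (fun n => (p n : ℝ) / (n : ℝ)) atTop (𝓝 y))
    (M : ∀ n, Ω n → Matrix (Fin (p n)) (Fin n) ℂ)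
    (C₀ : ℝ) (hC1 : RandomCovariance.ConditionC1 P p M C₀)
    (K : ℕ → ℝ) (hK : ∀ n, 1 < K n)
    (hbound : ∀ n i j, ∀ᵐ ω ∂(P n), ‖M n ω i j‖ ≤ K n)
    -- the law of the matrix `M n` is continuous, that is, it has no atoms
    (hcont : ∀ n, 0 < p n → ∀ A, P n {ω | M n ω = A} = 0)
    (ε : ℝ) (hε : 0 < ε) (δ : ℝ) (hδ : 0 < δ) :
    -- overwhelming probability: `≥ 1 - O_C(n ^ (-C))` for every `C > 0`, uniformly in `I`
    ∀ C : ℝ, 0 < C → ∃ B : ℝ, ∀ᶠ n : ℕ in atTop,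
      ∀ I : Set ℝ, I.OrdConnected →
        I ⊆ Set.Icc (RandomCovariance.edgeLeft y + ε) (RandomCovariance.edgeRight y - ε) →
        K n ^ 2 * Real.log n ^ 20 / n ≤ volume.real I →
        1 - B * (n : ℝ) ^ (-C) ≤
          (P n).real {ω |
            |(RandomCovariance.eigenvalueCount (hpn n) (M n ω) I : ℝ)
                - p n * ∫ x in I, RandomCovariance.marchenkoPastur y x| ≤ δ * p n} := by
  intro C hC
  obtain ⟨D, η₀, hD, hη₀, hstab⟩ := RandomCovariance.norm_sub_limitStieltjes_le hy0 hy1 hε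
  -- the scale `r` makes the deterministic errors small compared with `δ y`
  set L : ℝ := 1 + 4 * (1 + 1 / ε + 2 * D + 1) + 2 * D with hL
  have hLpos : 0 < L := by positivity
  set r : ℝ := min (min 1 η₀) (δ * y / (8 * L)) with hr
  have hrpos : 0 < r := by positivity
  have hr1 : r ≤ 1 := (min_le_left _ _).trans (min_le_left _ _)
  have hrη : r ≤ η₀ := (min_le_left _ _).trans (min_le_right _ _)
  have hrL : r * L ≤ δ * y / 8 := by
    have : r ≤ δ * y / (8 * L) := min_le_right _ _
    rw [le_div_iff₀ (by positivity)] at this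
    linarith
  have hr2r : r ^ 2 ≤ r := by nlinarith
  set s : ℝ := min 1 (δ * y / 8) with hs
  have hspos : 0 < s := by positivity
  set κ : ℕ → ℝ := fun n => 4 / Real.log n ^ 20 with hκ
  have hκ0 : Tendsto κ atTop (𝓝 0) :=
    ((tendsto_pow_atTop (by norm_num)).comp
      (Real.tendsto_log_atTop.comp tendsto_natCast_atTop_atTop)).const_div_atTop 4
  have hc : 0 < s ^ 2 * r ^ 4 / 32 := by positivity
  have ev1 := (RandomCovariance.tendsto_quadraticError hlim hκ0 hrpos).eventually
    (ge_mem_nhds one_pos)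
  have ev2 := (RandomCovariance.tendsto_quadraticError hlim hκ0
    (by positivity : 0 < r ^ 2)).eventually (ge_mem_nhds (by positivity : 0 < δ * y / (16 * D)))
  have ev3 : ∀ᶠ n : ℕ in atTop,
      |(p n : ℝ) / n - y| * (2 * (1 + 1 / ε) / y) ≤ δ * y / 8 := by
    have : Tendsto (fun n : ℕ => |(p n : ℝ) / n - y| * (2 * (1 + 1 / ε) / y)) atTop (𝓝 0) := by
      have := ((hlim.sub_const y).abs).mul_const (2 * (1 + 1 / ε) / y)
      simpa using this
    exact this.eventually (ge_mem_nhds (by positivity))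
  have ev4 : ∀ᶠ n : ℕ in atTop, y / 2 ≤ (p n : ℝ) / n :=
    hlim.eventually (le_mem_nhds (by linarith))
  have ev5 : ∀ᶠ n : ℕ in atTop,
      Real.exp (-(s ^ 2 * r ^ 4 / 32) * n) ≤ (n : ℝ) ^ (-C) := by
    have h := ((isLittleO_exp_neg_mul_rpow_atTop hc (-C)).comp_tendsto
      tendsto_natCast_atTop_atTop).bound one_pos
    filter_upwards [h] with n hn
    simp only [Function.comp_apply, one_mul] at hn
    rwa [Real.norm_of_nonneg (Real.exp_pos _).le, Real.norm_of_nonneg (by positivity)] at hn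
  refine ⟨6, ?_⟩
  filter_upwards [ev1, ev2, ev3, ev4, ev5, eventually_ge_atTop 2] with n h1 h2 h3 h4 h5 hn2
  intro I hIo hI hlen
  have hn : 0 < n := by omega
  have hn' : (0 : ℝ) < n := by exact_mod_cast hn
  have hlog : 0 < Real.log n := Real.log_pos (by exact_mod_cast hn2)
  have hp : 0 < p n := by
    rcases Nat.eq_zero_or_pos (p n) with h | h
    · rw [h] at h4
      simp at h4
      linarith
    · exact h
  obtain ⟨hfin, hvol⟩ := RandomCovariance.volume_bulk_le hy1 hε hI
  have hKn := hK n
  -- an interval of the required length exists only if `K² / n` is small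
  have hKκ : K n ^ 2 / n ≤ κ n := by
    have := hlen.trans hvol
    rw [div_le_iff₀ hn'] at this
    rw [hκ]
    simp only
    rw [div_le_div_iff₀ hn' (by positivity)]
    exact this
  have hne : I.Nonempty := by
    rw [Set.nonempty_iff_ne_empty]
    rintro rfl
    have : 0 < K n ^ 2 * Real.log n ^ 20 / n := by positivity
    simp at hlen
    linarith
  have hX : RandomCovariance.BoundedStandard
      (fun (ij : Fin (p n) × Fin n) ω => M n ω ij.1 ij.2) (P n) (K n) :=
    { indep := hC1.indep n
      measurable := fun ij => hC1.measurable n ij.1 ij.2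
      mean_zero := fun ij => hC1.mean_zero n ij.1 ij.2
      variance_one := fun ij => hC1.variance_one n ij.1 ij.2
      bound := fun ij => hbound n ij.1 ij.2 }
  have hE₁ := fun t ht => RandomCovariance.integral_norm_stieltjes_sub_limit_le
    (X := fun ω => M n ω) hX hKn.le hn (hpn n) hy1 hε hD.le hstab hrpos hrη hr1 hKκ (t := t) ht
  have hE₂ := fun t ht => RandomCovariance.integral_norm_stieltjes_sub_limit_le
    (X := fun ω => M n ω) hX hKn.le hn (hpn n) hy1 hε hD.le hstab (by positivity : 0 < r ^ 2)
    (hr2r.trans hrη) (hr2r.trans hr1) hKκ (t := t) ht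
  set q₁ := RandomCovariance.quadraticError (κ n) n (p n / n) y r with hq₁
  set q₂ := RandomCovariance.quadraticError (κ n) n (p n / n) y (r ^ 2) with hq₂
  have hq₂0 : 0 ≤ q₂ := by
    rw [hq₂]
    unfold RandomCovariance.quadraticError
    positivity
  have hmain := RandomCovariance.measure_eigenvalueCount_deviation_le (X := fun ω => M n ω) hX
    hp hn (hpn n) hy0 hy1 hε hIo hne hI hrpos hr1 hspos
    (min_le_left _ _) hE₁ hE₂ (by positivity)
  refine le_trans (by linarith) (hmain.trans (measureReal_mono ?_))
  intro ω hω
  simp only [Set.mem_ofPred_eq] at hω ⊢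
  set N : ℝ := (RandomCovariance.eigenvalueCount (hpn n) (M n ω) I : ℝ) with hN
  set J : ℝ := ∫ x in I, RandomCovariance.marchenkoPastur y x with hJ
  have hω' : |N / n - y * J| ≤ r + 4 * r * (1 + 1 / ε + D * (q₁ + r) + 1) + s +
      2 * (D * (q₂ + r ^ 2)) := hω
  have hJb : |J| ≤ 2 * (1 + 1 / ε) / y :=
    RandomCovariance.abs_integral_marchenkoPastur_le hy0 hy1 hε hI
  have e1 : r + 4 * r * (1 + 1 / ε + D * (q₁ + r) + 1) + s + 2 * (D * (q₂ + r ^ 2)) ≤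
      δ * y / 8 + δ * y / 8 + δ * y / 8 := by
    have a1 : D * (q₁ + r) ≤ 2 * D := by nlinarith
    have a2 : 4 * r * (1 + 1 / ε + D * (q₁ + r) + 1) ≤ 4 * r * (1 + 1 / ε + 2 * D + 1) := by
      gcongr
    have a3 : s ≤ δ * y / 8 := min_le_right _ _
    have a4 : 2 * (D * q₂) ≤ δ * y / 8 := by
      rw [le_div_iff₀ (by positivity)] at h2
      linarith
    have a5 : D * r ^ 2 ≤ D * r := mul_le_mul_of_nonneg_left hr2r hD.le
    have a6 : r * L = r + 4 * r * (1 + 1 / ε + 2 * D + 1) + 2 * (D * r) := by rw [hL]; ring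
    linarith
  have e2 : |y * J - p n / n * J| ≤ δ * y / 8 := by
    rw [← sub_mul, abs_mul, abs_sub_comm]
    exact (mul_le_mul_of_nonneg_left hJb (abs_nonneg _)).trans h3
  have e3 : |N / n - p n / n * J| ≤ δ * (p n / n) := by
    have := abs_sub_le (N / n) (y * J) (p n / n * J)
    have := mul_le_mul_of_nonneg_left h4 hδ.le
    linarith
  have e4 : N / n - p n / n * J = (N - p n * J) / n := by ring
  rw [e4, abs_div, abs_of_pos hn', div_le_iff₀ hn'] at e3
  refine e3.trans (le_of_eq ?_)
  field_simp
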